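/- Let $R$ be a ring. For a set $Y$ let $C_n(Y)$ be the free $R$-module on $Y^{n+1}$, whose elements $\sigma^n=(x_0,\dots,x_n)$ are called $n$-simplices, with boundary $\partial\sigma=\sum_i(-1)^i(x_0,\dots,\hat{x_i},\dots,x_n)$; for a chain $c$, $|c|$ denotes the set of simplices occurring in $c$ with nonzero coefficient. The diameter of $\sigma$ and the distance from $\sigma$ to a point are those of its vertex set. Let $V$ be the chain map from singular chains to $C_*$ sending a singular simplex to the tuple of its vertices. A metric space $X$ is uniformly contractible at infinity if there are a basepoint $b\in X$ and nondecreasing functions $\rho,\mu:[0,\infty)\to[0,\infty)$ such that every nonempty bounded set $B\subset X$ of diameter $r$ with $d(b,B)\ge\mu(r)$ is contractible inside some set $C\subset X$ of diameter at most $\rho(r)$ (that is, $B\subset C$ and the inclusion $B\to C$ is null-homotopic). **Proposition.** Let $\ell^\infty$ be the space of bounded real functions on a set $I$ with the sup metric (for instance $I=X$, with $X$ embedded by the Kuratowski embedding), let $X\subset\ell^\infty$, with the induced metric, be uniformly contractible at infinity, and let $b\in X$. Let $N(X)\supset X$ be open in $\ell^\infty$ and let $\mathcal U$ be a cover of $N(X)$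 by open sets; write $C^{\mathcal U}_*(N(X))$ for the complex of singular chains of $N(X)$ all of whose simplices have image inside a member of $\mathcal U$. Then there are functions $\rho_n,\mu_n:[0,\infty)\to[0,\infty)$ for $n\ge0$, each nondecreasing and with $\rho_n\le\rho_{n+1}$, $\mu_n\le\mu_{n+1}$, such that the modules $$C_n^F(X)=\langle\sigma^n\in X^{n+1} : d(\sigma^n,b)>\mu_n(\operatorname{diam}\sigma^n)\rangle\subset C_n(X)$$ form a subcomplex, and there are an $R$-linear chain map $S:C^F_*(X)\to C^{\mathcal U}_*(N(X))$ and $R$-linear maps $G:C^F_n(X)\to C_{n+1}(N(X))$ for $n\ge 0$ with the following properties. 1. $G$ is a chain homotopy between $VS$ and the inclusion $i:C^F_*(X)\to C_*(N(X))$: $\partial G(\sigma)=VS(\sigma)-i(\sigma)-G\partial(\sigma)$, where $G\partial(\sigma)=0$ in degree $0$. 2. For every $n$-simplex $\sigma^n$ in $C_n^F(X)$, all vertices of all simplices in $|G(\sigma^n)|$ lie in the open $\rho_n(\operatorname{diam}\sigma^n)$-neighborhood in $\ell^\infty$ of the vertex set of $\sigma^n$. 3. For every $k\in\mathbb N$ there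 is a bounded set $B\subset X$ such that for every $x\in X\setminus B$ and every neighborhood $U$ of $x$ in $\ell^\infty$ there is a neighborhood $W$ of $x$ in $X$ such that for all $n\le k$ and all $\sigma^n\in W^{n+1}$ one has $\sigma^n\in C_n^F(X)$ and $|G(\sigma^n)|\subset U^{n+2}$. -/

import Mathlib

open scoped NNReal ENNReal Topology

noncomputable section

namespace CoarseFilling

/-- The Banach space of bounded real functions on `I` with the supremum norm. -/
abbrev EllInf (I : Type*) : Type _ := lp (fun _ : I => ℝ) ∞

/-- The diameter of a set, as a nonnegative real (meaningful for bounded sets). -/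
def nndiam {Y : Type*} [PseudoMetricSpace Y] (s : Set Y) : ℝ≥0 :=
  ⟨Metric.diam s, Metric.diam_nonneg⟩

/-- `B` is contractible inside `C`: `B ⊆ C` and the inclusion `B → C` is homotopic, through
maps into `C`, to a constant map. -/
def ContractibleInside {Y : Type*} [TopologicalSpace Y] (B C : Set Y) : Prop :=
  ∃ h : B ⊆ C, (⟨Set.inclusion h, continuous_inclusion h⟩ : C(B, C)).Nullhomotopic

/-- Uniform contractibility at infinity: for some basepoint `b` and nondecreasing control
functions `ρ`, `μ`, every nonempty bounded set `B` with `d(b, B) ≥ μ (diam B)` is contractible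
inside a bounded set of diameter at most `ρ (diam B)`. -/
def UniformlyContractibleAtInfinity (Y : Type*) [PseudoMetricSpace Y] : Prop :=
  ∃ (b : Y) (ρ μ : ℝ≥0 → ℝ≥0), Monotone ρ ∧ Monotone μ ∧
    ∀ B : Set Y, B.Nonempty → Bornology.IsBounded B →
      μ (nndiam B) ≤ Metric.infNndist b B →
      ∃ C : Set Y, Bornology.IsBounded C ∧ nndiam C ≤ ρ (nndiam B) ∧ ContractibleInside B C

/-! ### Finitely supported chains on tuples -/

/-- Finitely supported `n`-chains: the free module on `Y^{n+1}`. -/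
abbrev TupleChain (R : Type*) [Ring R] (Y : Type*) (n : ℕ) : Type _ :=
  (Fin (n + 1) → Y) →₀ R

/-- `∂ (x₀, …, xₙ₊₁) = ∑ (-1)^i (x₀, …, x̂ᵢ, …, xₙ₊₁)`. -/
def tupleBoundary (R : Type*) [Ring R] (Y : Type*) (n : ℕ) :
    TupleChain R Y (n + 1) →ₗ[R] TupleChain R Y n :=
  Finsupp.linearCombination R fun σ =>
    ∑ i : Fin (n + 2), Finsupp.single (σ ∘ i.succAbove) ((-1 : R) ^ (i : ℕ))

/-- The map of chains induced by the inclusion of a subset. -/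
def tupleInclusion (R : Type*) [Ring R] {Y : Type*} {X N : Set Y} (h : X ⊆ N) (n : ℕ) :
    TupleChain R X n →ₗ[R] TupleChain R N n :=
  Finsupp.lmapDomain R R fun σ => Set.inclusion h ∘ σ

/-! ### Singular chains -/

/-- Singular `n`-simplices: continuous maps from the standard `n`-simplex. -/
abbrev SingularSimplex (Y : Type*) [TopologicalSpace Y] (n : ℕ) : Type _ :=
  C(stdSimplex ℝ (Fin (n + 1)), Y)

/-- Singular `n`-chains: the free module on the singular `n`-simplices. -/
abbrev SingularChain (R : Type*) [Ring R] (Y : Type*) [TopologicalSpace Y] (n : ℕ) : Type _ :=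
  SingularSimplex Y n →₀ R

/-- The `i`-th face of a singular simplex. -/
def singularFace {Y : Type*} [TopologicalSpace Y] {n : ℕ} (α : SingularSimplex Y (n + 1))
    (i : Fin (n + 2)) : SingularSimplex Y n :=
  α.comp ⟨stdSimplex.map i.succAbove, stdSimplex.continuous_map _⟩

/-- The singular boundary operator. -/
def singularBoundary (R : Type*) [Ring R] (Y : Type*) [TopologicalSpace Y] (n : ℕ) :
    SingularChain R Y (n + 1) →ₗ[R] SingularChain R Y n :=
  Finsupp.linearCombination R fun α =>
    ∑ i : Fin (n + 2), Finsupp.single (singularFace α i) ((-1 : R) ^ (i : ℕ))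

/-- The map `V` sending a singular simplex to the tuple of its vertices. -/
def vertexMap (R : Type*) [Ring R] (Y : Type*) [TopologicalSpace Y] (n : ℕ) :
    SingularChain R Y n →ₗ[R] TupleChain R Y n :=
  Finsupp.lmapDomain R R fun α i => α (stdSimplex.vertex i)

/-- The singular chains of `N` all of whose simplices have image inside a member of `𝒰`. -/
def smallChains (R : Type*) [Ring R] {Y : Type*} [TopologicalSpace Y] (N : Set Y)
    (𝒰 : Set (Set Y)) (n : ℕ) : Submodule R (SingularChain R N n) :=
  Finsupp.supported R R {α | ∃ U ∈ 𝒰, ∀ p, (α p : Y) ∈ U}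

/-! ### Far-out simplices -/

/-- The simplex `σ` satisfies `d(σ, b) > m (diam σ)`, where `d(σ, b)` and `diam σ` are the
distance to `b` and the diameter of the vertex set of `σ`. -/
def IsFar {Y : Type*} [PseudoMetricSpace Y] (b : Y) (m : ℝ≥0 → ℝ≥0) {n : ℕ}
    (σ : Fin (n + 1) → Y) : Prop :=
  m (nndiam (Set.range σ)) < Metric.infNndist b (Set.range σ)

/-- The module spanned by the `n`-simplices `σ` with `d(σ, b) > μ n (diam σ)`. -/
def farChains (R : Type*) [Ring R] {Y : Type*} [PseudoMetricSpace Y] (b : Y)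
    (μ : ℕ → ℝ≥0 → ℝ≥0) (n : ℕ) : Submodule R (TupleChain R Y n) :=
  Finsupp.supported R R {σ | IsFar b (μ n) σ}

/-- A far-out simplex, as an element of the module spanned by such simplices. -/
def farSimplex (R : Type*) [Ring R] {Y : Type*} [PseudoMetricSpace Y] {b : Y}
    {μ : ℕ → ℝ≥0 → ℝ≥0} {n : ℕ} (σ : Fin (n + 1) → Y) (hσ : IsFar b (μ n) σ) :
    farChains R b μ n :=
  ⟨Finsupp.single σ 1, Finsupp.single_mem_supported R 1 hσ⟩

end CoarseFilling

end

/-! A remote set of controlled diameter contracts inside a controlled set, so a cycle in it bounds: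
cut the contraction into finitely many time steps, sum the prisms between consecutive times, and
cone off the final constant image (`exists_filling`). Tuples of length 0 are kept, so that every
construction is an induction in the augmented complex.

Chains subordinate to a cover cannot be built directly in this way: a face belongs to infinitely
many simplices of all dimensions, and each would demand its own fineness of the face. Instead every
simplex receives a sequence of chains in one compact set with mesh tending to zero, a property that
fillings preserve if the time steps shrink as well (`Contracts.exists_seq_filling`). The stages are
chain maps, and consecutive stages are joined by homotopies `e j` with the same property. Choosing a
stage for each simplex and telescoping the `e j` gives one chain map that is as fine on each simplex
as that simplex requires (`exists_fine_chain_map`).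

For the last property the homotopy `G` is made to vanish on small remote tuples. A cover is pulled
back repeatedly along finitely many contractions of balls; on tuples small for the result, a fine
enough chain map is homotopic to the identity by a homotopy `T` subordinate to the original cover
(`exists_small_homotopy`). Extending `T` by zero and subtracting `∂T + T∂` yields a chain map that
is still subordinate and is the identity on small tuples. The conical homotopy with apex the first
vertex then vanishes on them (`exists_small_chain_map`).

Finally, tuples lying in a convex subset of `N` and of a member of `𝒰` span affine singular
simplices, whose vertices return the tuples. -/

noncomputable section

namespace CoarseFilling

/-! ### Augmented tuple chains -/

section Algebra

variable {R : Type*} [Ring R] {X Y Z : Type*} {n : ℕ}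

/-- Chains on tuples of length `n`; the tuple of length `0` provides the augmentation. -/
abbrev Tup (R : Type*) [Ring R] (Y : Type*) (n : ℕ) : Type _ := (Fin n → Y) →₀ R

/-- The basis element of a tuple. -/
abbrev tup (R : Type*) [Ring R] {Y : Type*} {n : ℕ} (τ : Fin n → Y) : Tup R Y n :=
  Finsupp.single τ 1

/-- The augmented boundary operator. -/
def bd (R : Type*) [Ring R] (Y : Type*) (n : ℕ) : Tup R Y (n + 1) →ₗ[R] Tup R Y n :=
  Finsupp.linearCombination R fun σ =>
    ∑ i : Fin (n + 1), Finsupp.single (σ ∘ i.succAbove) ((-1 : R) ^ (i : ℕ))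

theorem bd_tup (τ : Fin (n + 1) → Y) :
    bd R Y n (tup R τ) = ∑ i : Fin (n + 1), (-1 : R) ^ (i : ℕ) • tup R (τ ∘ i.succAbove) := by
  simp [bd, tup]

theorem map_mem_of_supported {M : Type*} [AddCommGroup M] [Module R M] {ι : Type*} {s : Set ι}
    {c : ι →₀ R} (hc : c ∈ Finsupp.supported R R s) (f : (ι →₀ R) →ₗ[R] M) (p : Submodule R M)
    (h : ∀ i ∈ s, f (Finsupp.single i 1) ∈ p) : f c ∈ p := by
  rw [Finsupp.mem_supported] at hc
  rw [← Finsupp.sum_single c, Finsupp.sum, map_sum]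
  refine Submodule.sum_mem _ fun i hi => ?_
  rw [← mul_one (c i), ← smul_eq_mul, ← Finsupp.smul_single, map_smul]
  exact p.smul_mem _ (h i (hc hi))

theorem map_eq_of_supported {M : Type*} [AddCommGroup M] [Module R M] {ι : Type*} {s : Set ι}
    {c : ι →₀ R} (hc : c ∈ Finsupp.supported R R s) (f g : (ι →₀ R) →ₗ[R] M)
    (h : ∀ i ∈ s, f (Finsupp.single i 1) = g (Finsupp.single i 1)) : f c = g c := by
  have := map_mem_of_supported hc (f - g) ⊥ (fun i hi => by simp [h i hi])
  simpa [sub_eq_zero] using this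

theorem supported_weaken {ι : Type*} {s t : Set ι} {c : ι →₀ R}
    (hc : c ∈ Finsupp.supported R R s) (h : ∀ i ∈ s, i ∈ t) : c ∈ Finsupp.supported R R t :=
  Finsupp.supported_mono h hc

theorem tup_mem_supported {τ : Fin n → Y} {s : Set (Fin n → Y)} (h : τ ∈ s) :
    tup R τ ∈ Finsupp.supported R R s := Finsupp.single_mem_supported R 1 h

theorem bd_tup_mem {τ : Fin (n + 1) → Y} {s : Set (Fin n → Y)}
    (h : ∀ i : Fin (n + 1), τ ∘ i.succAbove ∈ s) :
    bd R Y n (tup R τ) ∈ Finsupp.supported R R s := by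
  rw [bd_tup]
  exact Submodule.sum_mem _ fun i _ => Submodule.smul_mem _ _ (tup_mem_supported (h i))

/-- The cone operator. -/
def cone (R : Type*) [Ring R] {Y : Type*} (x : Y) (n : ℕ) : Tup R Y n →ₗ[R] Tup R Y (n + 1) :=
  Finsupp.lmapDomain R R fun τ => (Fin.cons x τ : Fin (n + 1) → Y)

theorem cone_tup (x : Y) (τ : Fin n → Y) :
    cone R x n (tup R τ) = tup R (Fin.cons x τ : Fin (n + 1) → Y) := by
  simp [cone, tup]

theorem bd_cone_zero (x : Y) (c : Tup R Y 0) : bd R Y 0 (cone R x 0 c) = c := by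
  refine map_eq_of_supported (s := Set.univ) (by simp) (bd R Y 0 ∘ₗ cone R x 0) LinearMap.id ?_
  intro τ _
  rw [LinearMap.comp_apply, cone_tup, bd_tup]
  simp only [Fin.sum_univ_succ, Finset.univ_eq_empty, Finset.sum_empty]
  simp [tup, Subsingleton.elim (_ : Fin 0 → Y) τ]

/-- Omitting the apex returns the chain; omitting a later entry gives the cone over a face, with the
sign shifted by one. -/
theorem bd_cone_succ (x : Y) (c : Tup R Y (n + 1)) :
    bd R Y (n + 1) (cone R x (n + 1) c) = c - cone R x n (bd R Y n c) := by
  refine map_eq_of_supported (s := Set.univ) (by simp) (bd R Y (n + 1) ∘ₗ cone R x (n + 1))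
    (LinearMap.id - cone R x n ∘ₗ bd R Y n) ?_
  intro τ _
  rw [LinearMap.comp_apply, cone_tup, bd_tup, Fin.sum_univ_succ]
  simp only [LinearMap.sub_apply, LinearMap.comp_apply, LinearMap.id_apply]
  rw [bd_tup, map_sum, sub_eq_add_neg, ← Finset.sum_neg_distrib]
  congr 1
  · simp only [Fin.val_zero, pow_zero, one_smul]
    congr 1
  · refine Finset.sum_congr rfl fun i _ => ?_
    rw [map_smul, cone_tup, Fin.val_succ, pow_succ, mul_neg_one, neg_smul]
    congr 3
    funext j
    refine Fin.cases ?_ (fun k => ?_) j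
    · simp
    · simp [Function.comp]

/-- A nonempty tuple is the cone over its tail, so the cone formula reduces the claim to one degree
lower. -/
theorem bd_bd (c : Tup R Y (n + 2)) : bd R Y n (bd R Y (n + 1) c) = 0 := by
  induction n with
  | zero =>
    refine map_eq_of_supported (s := Set.univ) (by simp) (bd R Y 0 ∘ₗ bd R Y 1) 0 ?_
    intro τ _
    have : tup R τ = cone R (τ 0) 1 (tup R (Fin.tail τ)) := by
      rw [cone_tup, Fin.cons_self_tail]
    change bd R Y 0 (bd R Y 1 (tup R τ)) = 0
    rw [this, bd_cone_succ, map_sub, bd_cone_zero, sub_self]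
  | succ n ih =>
    refine map_eq_of_supported (s := Set.univ) (by simp) (bd R Y (n + 1) ∘ₗ bd R Y (n + 2)) 0 ?_
    intro τ _
    have : tup R τ = cone R (τ 0) (n + 2) (tup R (Fin.tail τ)) := by
      rw [cone_tup, Fin.cons_self_tail]
    change bd R Y (n + 1) (bd R Y (n + 2) (tup R τ)) = 0
    rw [this, bd_cone_succ, map_sub, bd_cone_succ, ih, map_zero, sub_zero, sub_self]

theorem cone_mem {x : Y} {Q : Set Y} (hx : x ∈ Q) {c : Tup R Y n}
    (hc : c ∈ Finsupp.supported R R {τ | ∀ i, τ i ∈ Q}) :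
    cone R x n c ∈ Finsupp.supported R R {τ : Fin (n + 1) → Y | ∀ i, τ i ∈ Q} := by
  refine map_mem_of_supported hc _ _ fun τ hτ => ?_
  change cone R x n (tup R τ) ∈ _
  rw [cone_tup]
  exact tup_mem_supported fun i => Fin.cases (by simpa using hx) (fun j => by simpa using hτ j) i

/-- The map induced on chains by a map of sets. -/
def mapTup (R : Type*) [Ring R] (f : X → Y) (n : ℕ) : Tup R X n →ₗ[R] Tup R Y n :=
  Finsupp.lmapDomain R R fun τ => f ∘ τ

theorem mapTup_tup (f : X → Y) (τ : Fin n → X) : mapTup R f n (tup R τ) = tup R (f ∘ τ) := by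
  simp [mapTup, tup]

theorem bd_mapTup (f : X → Y) (c : Tup R X (n + 1)) :
    bd R Y n (mapTup R f (n + 1) c) = mapTup R f n (bd R X n c) := by
  refine map_eq_of_supported (s := Set.univ) (by simp) (bd R Y n ∘ₗ mapTup R f (n + 1))
    (mapTup R f n ∘ₗ bd R X n) ?_
  intro τ _
  change bd R Y n (mapTup R f (n + 1) (tup R τ)) = mapTup R f n (bd R X n (tup R τ))
  rw [mapTup_tup, bd_tup, bd_tup, map_sum]
  simp only [map_smul, mapTup_tup, Function.comp_assoc]

theorem mapTup_eq_self {f : X → X} {c : Tup R X n} {s : Set (Fin n → X)}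
    (hc : c ∈ Finsupp.supported R R s) (h : ∀ τ ∈ s, ∀ i, f (τ i) = τ i) :
    mapTup R f n c = c := by
  refine map_eq_of_supported hc (mapTup R f n) LinearMap.id fun τ hτ => ?_
  change mapTup R f n (tup R τ) = tup R τ
  rw [mapTup_tup]
  congr 1
  funext i
  exact h τ hτ i

/-- The conical homotopy from `0` to `Φ`. -/
def htpy (Φ : ∀ n, Tup R X n →ₗ[R] Tup R Y n) (a : X → Y) :
    ∀ n, Tup R X n →ₗ[R] Tup R Y (n + 1)
  | 0 => 0
  | n + 1 => Finsupp.linearCombination R fun τ =>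
      cone R (a (τ 0)) (n + 1)
        (Φ (n + 1) (tup R τ) - htpy Φ a n (bd R X n (tup R τ)))

theorem htpy_tup (Φ : ∀ n, Tup R X n →ₗ[R] Tup R Y n) (a : X → Y) (τ : Fin (n + 1) → X) :
    htpy Φ a (n + 1) (tup R τ) = cone R (a (τ 0)) (n + 1)
        (Φ (n + 1) (tup R τ) - htpy Φ a n (bd R X n (tup R τ))) := by
  simp [htpy, tup]

/-- As `A` is closed under faces, induction shows that the chain being coned is a cycle, so the
second term of the cone formula disappears. Everything is restricted to `A` because `Φ` is a chain
map only there. -/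
theorem bd_htpy {Φ : ∀ n, Tup R X n →ₗ[R] Tup R Y n} (a : X → Y)
    {A : ∀ n, Set (Fin n → X)}
    (hA : ∀ n, ∀ τ ∈ A (n + 1), ∀ i : Fin (n + 1), τ ∘ i.succAbove ∈ A n) (h0 : Φ 0 = 0)
    (hΦ : ∀ n, ∀ τ ∈ A (n + 1), bd R Y n (Φ (n + 1) (tup R τ)) = Φ n (bd R X n (tup R τ)))
    (n : ℕ) : ∀ τ ∈ A (n + 1), bd R Y (n + 1) (htpy Φ a (n + 1) (tup R τ)) =
      Φ (n + 1) (tup R τ) - htpy Φ a n (bd R X n (tup R τ)) := by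
  induction n with
  | zero =>
    intro τ hτ
    rw [htpy_tup, bd_cone_succ, map_sub, hΦ 0 τ hτ, h0]
    simp [htpy]
  | succ n ih =>
    intro τ hτ
    rw [htpy_tup, bd_cone_succ, map_sub, hΦ _ τ hτ]
    have := map_eq_of_supported (bd_tup_mem (R := R) (hA _ τ hτ))
      (bd R Y (n + 1) ∘ₗ htpy Φ a (n + 1)) (Φ (n + 1) - htpy Φ a n ∘ₗ bd R X n) ih
    simp only [LinearMap.comp_apply, LinearMap.sub_apply, bd_bd, map_zero, sub_zero] at this
    rw [this, sub_self, map_zero, sub_zero]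

theorem htpy_mem {Φ : ∀ n, Tup R X n →ₗ[R] Tup R Y n} {a : X → Y}
    {A : ∀ n, Set (Fin n → X)}
    (hA : ∀ n, ∀ τ ∈ A (n + 1), ∀ i : Fin (n + 1), τ ∘ i.succAbove ∈ A n)
    {N : ∀ n, (Fin n → X) → Set Y}
    (hN : ∀ n, ∀ τ ∈ A (n + 1), ∀ i : Fin (n + 1), N n (τ ∘ i.succAbove) ⊆ N (n + 1) τ)
    (ha : ∀ n, ∀ τ ∈ A (n + 1), a (τ 0) ∈ N (n + 1) τ)
    (hΦ : ∀ n, ∀ τ ∈ A (n + 1),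
      Φ (n + 1) (tup R τ) ∈ Finsupp.supported R R {υ | ∀ i, υ i ∈ N (n + 1) τ})
    (n : ℕ) : ∀ τ ∈ A n,
      htpy Φ a n (tup R τ) ∈ Finsupp.supported R R {υ : Fin (n + 1) → Y | ∀ i, υ i ∈ N n τ} := by
  induction n with
  | zero => intro τ _; simp [htpy]
  | succ n ih =>
    intro τ hτ
    rw [htpy_tup]
    refine cone_mem (ha n τ hτ) (Submodule.sub_mem _ (hΦ n τ hτ) ?_)
    rw [bd_tup, map_sum]
    refine Submodule.sum_mem _ fun i _ => ?_
    rw [map_smul]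
    refine Submodule.smul_mem _ _ (Finsupp.supported_mono ?_ (ih _ (hA n τ hτ i)))
    exact fun υ hυ j => hN n τ hτ i (hυ j)

theorem htpy_eq_zero {Φ : ∀ n, Tup R X n →ₗ[R] Tup R Y n} {a : X → Y}
    {A : ∀ n, Set (Fin n → X)}
    (hA : ∀ n, ∀ τ ∈ A (n + 1), ∀ i : Fin (n + 1), τ ∘ i.succAbove ∈ A n)
    (hΦ : ∀ n, ∀ τ ∈ A (n + 1), Φ (n + 1) (tup R τ) = 0) (n : ℕ) :
    ∀ τ ∈ A n, htpy Φ a n (tup R τ) = 0 := by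
  induction n with
  | zero => intro τ _; simp [htpy]
  | succ n ih =>
    intro τ hτ
    rw [htpy_tup, hΦ n τ hτ, bd_tup, map_sum]
    rw [Finset.sum_eq_zero fun i _ => by rw [map_smul, ih _ (hA n τ hτ i), smul_zero]]
    simp

/-- The prism operator between two maps. -/
def prism (R : Type*) [Ring R] (f g : X → Y) : ∀ n, Tup R X n →ₗ[R] Tup R Y (n + 1) :=
  htpy (fun n => mapTup R g n - mapTup R f n) f

theorem prism_zero (f g : X → Y) : prism R f g 0 = 0 := rfl

theorem bd_prism (f g : X → Y) (c : Tup R X (n + 1)) : bd R Y (n + 1) (prism R f g (n + 1) c) =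
    mapTup R g (n + 1) c - mapTup R f (n + 1) c - prism R f g n (bd R X n c) := by
  refine map_eq_of_supported (s := Set.univ) (by simp) (bd R Y (n + 1) ∘ₗ prism R f g (n + 1))
    (mapTup R g (n + 1) - mapTup R f (n + 1) - prism R f g n ∘ₗ bd R X n) fun τ _ => ?_
  refine bd_htpy (Φ := fun n => mapTup R g n - mapTup R f n) f (A := fun _ => Set.univ)
    (fun _ _ _ _ => trivial) ?_ (fun n τ _ => ?_) n τ trivial
  · ext τ : 2
    change mapTup R g 0 (tup R τ) - mapTup R f 0 (tup R τ) = 0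
    rw [mapTup_tup, mapTup_tup, Subsingleton.elim (g ∘ τ) (f ∘ τ), sub_self]
  · simp [bd_mapTup]

theorem prism_mem (f g : X → Y) (τ : Fin n → X) : prism R f g n (tup R τ) ∈
    Finsupp.supported R R {υ : Fin (n + 1) → Y | ∀ i, ∃ p, υ i = f (τ p) ∨ υ i = g (τ p)} := by
  refine htpy_mem (Φ := fun n => mapTup R g n - mapTup R f n) (A := fun _ => Set.univ)
    (fun _ _ _ _ => trivial) (N := fun n τ => {y | ∃ p, y = f (τ p) ∨ y = g (τ p)})
    ?_ ?_ ?_ n τ trivial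
  · rintro n τ - i y ⟨p, hp⟩
    exact ⟨_, hp⟩
  · exact fun n τ _ => ⟨0, Or.inl rfl⟩
  · intro n τ _
    rw [LinearMap.sub_apply, mapTup_tup, mapTup_tup]
    exact Submodule.sub_mem _ (tup_mem_supported fun i => ⟨i, Or.inr rfl⟩)
      (tup_mem_supported fun i => ⟨i, Or.inl rfl⟩)

/-- Cycles of the augmented complex. -/
def IsCyc : ∀ {n : ℕ}, Tup R Y n → Prop
  | 0, _ => True
  | n + 1, z => bd R Y n z = 0

theorem isCyc_succ {z : Tup R Y (n + 1)} : IsCyc z ↔ bd R Y n z = 0 := Iff.rfl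

/-- A cycle bounds along a finite sequence of maps from the identity to a constant map. -/
theorem exists_filling (f : ℕ → X → X) (m : ℕ) (c : X) {z : Tup R X n} (hz : IsCyc z)
    {s : Set (Fin n → X)} (hzs : z ∈ Finsupp.supported R R s)
    (h0 : ∀ τ ∈ s, ∀ i, f 0 (τ i) = τ i) (hm : ∀ τ ∈ s, ∀ i, f m (τ i) = c)
    {M : Set (Fin (n + 1) → X)} (hc : (fun _ => c) ∈ M)
    (hM : ∀ τ ∈ s, ∀ k < m, ∀ υ : Fin (n + 1) → X,
      (∀ i, ∃ p, υ i = f k (τ p) ∨ υ i = f (k + 1) (τ p)) → υ ∈ M) :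
    ∃ w : Tup R X (n + 1), bd R X n w = z ∧ w ∈ Finsupp.supported R R M := by
  -- For a cycle the boundaries of the prisms telescope to `f m z - f 0 z`, while the cone has
  -- boundary `f m z`; the difference is `f 0 z = z`.
  refine ⟨cone R c n (mapTup R (f m) n z) -
    ∑ k ∈ Finset.range m, prism R (f k) (f (k + 1)) n z, ?_, Submodule.sub_mem _ ?_ ?_⟩
  · cases n with
    | zero =>
      simp only [prism_zero, LinearMap.zero_apply, Finset.sum_const_zero, sub_zero, bd_cone_zero]
      exact mapTup_eq_self hzs fun τ _ i => i.elim0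
    | succ n =>
      have hz' : bd R X n z = 0 := hz
      simp only [map_sub, map_sum, bd_cone_succ, bd_mapTup, hz', map_zero, sub_zero, bd_prism]
      rw [Finset.sum_range_sub (fun k => mapTup R (f k) (n + 1) z), sub_sub_cancel]
      exact mapTup_eq_self hzs h0
  · refine map_mem_of_supported hzs (cone R c n ∘ₗ mapTup R (f m) n) _ fun τ hτ => ?_
    change cone R c n (mapTup R (f m) n (tup R τ)) ∈ _
    rw [mapTup_tup, cone_tup]
    refine tup_mem_supported ?_
    convert hc with i
    exact Fin.cases (by simp) (fun j => by simpa using hm τ hτ j) i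
  · refine Submodule.sum_mem _ fun k hk => ?_
    refine map_mem_of_supported hzs _ _ fun τ hτ => ?_
    exact Finsupp.supported_mono (fun υ hυ => hM τ hτ k (Finset.mem_range.1 hk) υ hυ)
      (prism_mem (R := R) (f k) (f (k + 1)) τ)

end Algebra

/-! ### Contractions and asymptotically small sequences of chains -/

section Sequences

open Set Filter

variable {R : Type*} [Ring R] {X : Type*} [MetricSpace X] {n : ℕ}

/-- `H` contracts `B` to the point `c` inside `D`. -/
structure Contracts (H : ℝ → X → X) (B : Set X) (c : X) (D : Set X) : Prop where
  cont : ContinuousOn (fun p : ℝ × X => H p.1 p.2) (Icc 0 1 ×ˢ B)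
  zero : ∀ y ∈ B, H 0 y = y
  one : ∀ y ∈ B, H 1 y = c
  mem : ∀ t ∈ Icc (0 : ℝ) 1, ∀ y ∈ B, H t y ∈ D
  center_mem : c ∈ D

/-- The distance from `y` to a tuple is at most `a`. -/
def nhd (τ : Fin n → X) (a : ℝ≥0) : Set X := {y | ∃ i, nndist y (τ i) ≤ a}

/-- Sequences of chains carried by a compact subset of `B` whose simplices become arbitrarily
small. -/
def ctl (R : Type*) [Ring R] {X : Type*} [MetricSpace X] (n : ℕ) (B : Set X) :
    Submodule R (ℕ → Tup R X n) where
  -- One compact set serves all stages; it supplies uniform continuity and Lebesgue numbers.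
  carrier := {z | (∃ Q ⊆ B, IsCompact Q ∧
      ∀ j, z j ∈ Finsupp.supported R R {τ : Fin n → X | ∀ p, τ p ∈ Q}) ∧
    ∀ ε > 0, ∀ᶠ j in atTop, z j ∈ Finsupp.supported R R {τ | ∀ p q, dist (τ p) (τ q) < ε}}
  add_mem' := by
    rintro z w ⟨⟨Q, hQ, hQc, hzQ⟩, hz⟩ ⟨⟨Q', hQ', hQc', hwQ⟩, hw⟩
    refine ⟨⟨Q ∪ Q', union_subset hQ hQ', hQc.union hQc', fun j => ?_⟩, fun ε hε => ?_⟩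
    · exact Submodule.add_mem _
        (supported_weaken (hzQ j) fun τ hτ p => Or.inl (hτ p))
        (supported_weaken (hwQ j) fun τ hτ p => Or.inr (hτ p))
    · filter_upwards [hz ε hε, hw ε hε] with j h1 h2
      exact Submodule.add_mem _ h1 h2
  zero_mem' := ⟨⟨∅, empty_subset _, isCompact_empty, fun _ => Submodule.zero_mem _⟩,
    fun _ _ => Eventually.of_forall fun _ => Submodule.zero_mem _⟩
  smul_mem' := by
    rintro r z ⟨⟨Q, hQ, hQc, hzQ⟩, hz⟩
    refine ⟨⟨Q, hQ, hQc, fun j => Submodule.smul_mem _ _ (hzQ j)⟩, fun ε hε => ?_⟩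
    filter_upwards [hz ε hε] with j h1
    exact Submodule.smul_mem _ _ h1

theorem ctl_mono {B C : Set X} (h : B ⊆ C) : ctl R n B ≤ ctl R n C := by
  rintro z ⟨⟨Q, hQ, hQc, hzQ⟩, hz⟩
  exact ⟨⟨Q, hQ.trans h, hQc, hzQ⟩, hz⟩

theorem ctl_shift {B : Set X} {z : ℕ → Tup R X n} (hz : z ∈ ctl R n B) :
    (fun j => z (j + 1)) ∈ ctl R n B := by
  obtain ⟨⟨Q, hQ, hQc, hzQ⟩, hz⟩ := hz
  exact ⟨⟨Q, hQ, hQc, fun j => hzQ (j + 1)⟩,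
    fun ε hε => (tendsto_add_atTop_nat 1).eventually (hz ε hε)⟩

theorem ctl_mem_supported {B : Set X} {z : ℕ → Tup R X n} (hz : z ∈ ctl R n B) (j : ℕ) :
    z j ∈ Finsupp.supported R R {τ : Fin n → X | ∀ p, τ p ∈ B} := by
  obtain ⟨⟨Q, hQ, -, hzQ⟩, -⟩ := hz
  exact supported_weaken (hzQ j) fun τ hτ p => hQ (hτ p)

/-- A tuple contained in a member of a family of sets. -/
def smallTup (𝒱 : Set (Set X)) (n : ℕ) : Set (Fin n → X) := {τ | ∃ V ∈ 𝒱, ∀ p, τ p ∈ V}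

theorem ctl_eventually_small {B : Set X} {z : ℕ → Tup R X (n + 1)} (hz : z ∈ ctl R (n + 1) B)
    {𝒱 : Set (Set X)} (ho : ∀ V ∈ 𝒱, IsOpen V) (hc : ⋃₀ 𝒱 = univ) :
    ∀ᶠ j in atTop, z j ∈ Finsupp.supported R R (smallTup 𝒱 (n + 1)) := by
  obtain ⟨⟨Q, -, hQc, hzQ⟩, hz⟩ := hz
  obtain ⟨δ, hδ, h⟩ := lebesgue_number_lemma_of_metric_sUnion hQc ho (by simp [hc])
  filter_upwards [hz δ hδ] with j hj
  rw [Finsupp.mem_supported] at hj ⊢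
  intro τ hτ
  have h1 := (Finsupp.mem_supported R _).1 (hzQ j) hτ
  obtain ⟨V, hV, hb⟩ := h (τ 0) (h1 0)
  exact ⟨V, hV, fun p => hb (hj hτ p 0)⟩

/-- Stage `j` cuts the contraction into `j + 1` steps. The contraction is uniformly continuous on
the product of the unit interval with the compact carrier, so the fillings become small because both
the time step and the mesh of `z j` do. -/
theorem Contracts.exists_seq_filling {H : ℝ → X → X} {B : Set X} {c : X} {D : Set X}
    (hH : Contracts H B c D) {z : ℕ → Tup R X n} (hz : z ∈ ctl R n B) (hcyc : ∀ j, IsCyc (z j)) :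
    ∃ w ∈ ctl R (n + 1) D, ∀ j, bd R X n (w j) = z j := by
  obtain ⟨⟨Q, hQ, hQc, hzQ⟩, hz⟩ := hz
  let f : ℕ → ℕ → X → X := fun j k => H ((k : ℝ) / (j + 1))
  have hI : ∀ j k : ℕ, k ≤ j + 1 → (k : ℝ) / (j + 1) ∈ Icc (0 : ℝ) 1 := fun j k hk =>
    ⟨by positivity, by rw [div_le_one (by positivity)]; exact_mod_cast hk⟩
  have hcpt : IsCompact (Icc (0 : ℝ) 1 ×ˢ Q) := isCompact_Icc.prod hQc
  have hcont : ContinuousOn (fun p : ℝ × X => H p.1 p.2) (Icc 0 1 ×ˢ Q) :=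
    hH.cont.mono (prod_mono_right hQ)
  -- The apex is added separately: it is not in the image when `Q` is empty.
  let Q' : Set X := insert c ((fun p : ℝ × X => H p.1 p.2) '' (Icc 0 1 ×ˢ Q))
  have hQ'c : IsCompact Q' := (hcpt.image_of_continuousOn hcont).insert c
  have hQ' : Q' ⊆ D := by
    rintro y (rfl | ⟨⟨t, x⟩, ⟨ht, hx⟩, rfl⟩)
    · exact hH.center_mem
    · exact hH.mem t ht x (hQ hx)
  -- the simplices of the filling, at stage `j`
  let Z : ℕ → Set (Fin n → X) := fun j => (z j).support
  let M : ℕ → Set (Fin (n + 1) → X) := fun j => {υ | (υ = fun _ => c) ∨ ∃ τ ∈ Z j, ∃ k < j + 1,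
    ∀ i, ∃ p, υ i = f j k (τ p) ∨ υ i = f j (k + 1) (τ p)}
  have hZ : ∀ j, ∀ τ ∈ Z j, ∀ p, τ p ∈ Q := fun j τ hτ =>
    (Finsupp.mem_supported R _).1 (hzQ j) hτ
  have key : ∀ j, ∃ w : Tup R X (n + 1), bd R X n w = z j ∧ w ∈ Finsupp.supported R R (M j) := by
    intro j
    refine exists_filling (f j) (j + 1) c (hcyc j) (s := Z j) (by simp [Z, Finsupp.mem_supported])
      ?_ ?_ (Or.inl rfl) ?_
    · intro τ hτ i
      simpa [f] using hH.zero _ (hQ (hZ j τ hτ i))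
    · intro τ hτ i
      have : (((j + 1 : ℕ) : ℝ) / (j + 1)) = 1 := by
        rw [Nat.cast_add_one]; exact div_self (by positivity)
      simpa only [f, this] using hH.one _ (hQ (hZ j τ hτ i))
    · exact fun τ hτ k hk υ hυ => Or.inr ⟨τ, hτ, k, hk, hυ⟩
  choose w hw hwM using key
  refine ⟨w, ⟨⟨Q', hQ', hQ'c, fun j => Finsupp.supported_mono ?_ (hwM j)⟩, fun ε hε => ?_⟩, hw⟩
  · rintro υ (rfl | ⟨τ, hτ, k, hk, h⟩) p
    · exact Or.inl rfl
    · obtain ⟨q, hq | hq⟩ := h p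
      · exact Or.inr ⟨(_, τ q), ⟨hI j k hk.le, hZ j τ hτ q⟩, hq.symm⟩
      · exact Or.inr ⟨(_, τ q), ⟨hI j (k + 1) hk, hZ j τ hτ q⟩, hq.symm⟩
  · obtain ⟨δ, hδ, hu⟩ := Metric.uniformContinuousOn_iff.1
      (hcpt.uniformContinuousOn_of_continuous hcont) ε hε
    obtain ⟨J, hJ⟩ := exists_nat_one_div_lt hδ
    filter_upwards [hz δ hδ, eventually_ge_atTop J] with j hj hjJ
    refine Finsupp.supported_mono ?_ (hwM j)
    have hstep : (1 : ℝ) / (j + 1) < δ :=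
      lt_of_le_of_lt (one_div_le_one_div_of_le (by positivity) (by gcongr)) hJ
    rintro υ (rfl | ⟨τ, hτ, k, hk, h⟩) p q
    · simpa using hε
    have hd := (Finsupp.mem_supported R _).1 hj hτ
    have aux : ∀ k₁ k₂ : ℕ, (k₁ = k ∨ k₁ = k + 1) → (k₂ = k ∨ k₂ = k + 1) → ∀ p' q',
        dist (f j k₁ (τ p')) (f j k₂ (τ q')) < ε := by
      intro k₁ k₂ h₁ h₂ p' q'
      refine hu ((k₁ : ℝ) / (j + 1), τ p') ⟨hI j k₁ (by omega), hZ j τ hτ p'⟩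
        ((k₂ : ℝ) / (j + 1), τ q') ⟨hI j k₂ (by omega), hZ j τ hτ q'⟩ ?_
      rw [Prod.dist_eq]
      refine max_lt ?_ (hd p' q')
      refine lt_of_le_of_lt ?_ hstep
      simp only [Real.dist_eq]
      rw [← sub_div, abs_div, abs_of_pos (by positivity : (0 : ℝ) < j + 1)]
      gcongr
      rcases h₁ with rfl | rfl <;> rcases h₂ with rfl | rfl <;> push_cast <;> simp
    obtain ⟨p', hp⟩ := h p
    obtain ⟨q', hq⟩ := h q
    rcases hp with hp | hp <;> rcases hq with hq | hq <;> rw [hp, hq] <;>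
      exact aux _ _ (by simp) (by simp) _ _

/-- Recursion over degrees: `P` carries the control and the fact that the next chains to be filled
are cycles, `Q` the boundary formula linking consecutive degrees. -/
theorem exists_dependent_seq {β : ℕ → Type*} (P : ∀ n, β n → Prop)
    (Q : ∀ n, β n → β (n + 1) → Prop) (x₀ : β 0) (h₀ : P 0 x₀)
    (h : ∀ n x, P n x → ∃ y, P (n + 1) y ∧ Q n x y) :
    ∃ f : ∀ n, β n, f 0 = x₀ ∧ (∀ n, P n (f n)) ∧ ∀ n, Q n (f n) (f (n + 1)) := by
  choose g hg using h
  let F : ∀ n, {x : β n // P n x} := fun n =>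
    Nat.rec (motive := fun n => {x : β n // P n x}) ⟨x₀, h₀⟩
      (fun n x => ⟨g n x.1 x.2, (hg n x.1 x.2).1⟩) n
  exact ⟨fun n => (F n).1, rfl, fun n => (F n).2, fun n => (hg n (F n).1 (F n).2).2⟩

/-- Fillings are chosen on basis elements in `A`; values on the others are arbitrary, so later
identities hold only on far-out tuples. -/
theorem exists_linear_extension {ι M : Type*} [AddCommGroup M] [Module R M] {A : Set ι}
    {p : ι → M → Prop} (h : ∀ i ∈ A, ∃ x, p i x) :
    ∃ f : (ι →₀ R) →ₗ[R] M, ∀ i ∈ A, p i (f (Finsupp.single i 1)) := by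
  classical
  choose! g hg using h
  exact ⟨Finsupp.linearCombination R g, fun i hi => by simpa using hg i hi⟩

end Sequences

/-! ### Radii, thresholds and contractions around tuples -/

section Radii

open Set Filter

/-- The control radii obtained by iterating contractions. -/
def radius (ρ : ℝ≥0 → ℝ≥0) : ℕ → ℝ≥0 → ℝ≥0
  | 0, _ => 0
  -- The neighborhood of radius `r` of a tuple of diameter `d` has diameter at most `d + 2 * r`.
  | n + 1, d => radius ρ n d + ρ (d + 2 * radius ρ n d) + 1

/-- The distance from the basepoint that allows contractions of neighborhoods of radius
`radius ρ n`. -/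
def threshold (ρ μ : ℝ≥0 → ℝ≥0) (n : ℕ) (d : ℝ≥0) : ℝ≥0 :=
  μ (d + 2 * radius ρ n d) + radius ρ n d

variable {ρ μ : ℝ≥0 → ℝ≥0}

theorem radius_mono_left (d : ℝ≥0) : Monotone fun n => radius ρ n d :=
  monotone_nat_of_le_succ fun n => by
    change radius ρ n d ≤ radius ρ n d + ρ (d + 2 * radius ρ n d) + 1
    rw [add_assoc]
    exact le_self_add

theorem radius_mono_right (hρ : Monotone ρ) (n : ℕ) : Monotone (radius ρ n) := by
  induction n with
  | zero => exact fun _ _ _ => le_rfl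
  | succ n ih =>
    intro d e h
    have h1 := ih h
    have h2 : ρ (d + 2 * radius ρ n d) ≤ ρ (e + 2 * radius ρ n e) := hρ (by gcongr)
    exact add_le_add_left (add_le_add h1 h2) 1

theorem radius_mono (hρ : Monotone ρ) {m n : ℕ} {d e : ℝ≥0} (hmn : m ≤ n) (hde : d ≤ e) :
    radius ρ m d ≤ radius ρ n e :=
  (radius_mono_left d hmn).trans (radius_mono_right hρ n hde)

theorem threshold_mono (hρ : Monotone ρ) (hμ : Monotone μ) {m n : ℕ} {d e : ℝ≥0} (hmn : m ≤ n)
    (hde : d ≤ e) : threshold ρ μ m d ≤ threshold ρ μ n e := by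
  have h := radius_mono hρ hmn hde
  exact add_le_add (hμ (by gcongr)) h

variable {X : Type*} [MetricSpace X] {n : ℕ}

theorem nndiam_mono {s t : Set X} (h : s ⊆ t) (ht : Bornology.IsBounded t) :
    nndiam s ≤ nndiam t := Metric.diam_mono h ht

/-- The diameter of a tuple. -/
def tdiam (τ : Fin n → X) : ℝ≥0 := nndiam (range τ)

theorem tdiam_le_of_range_subset {m : ℕ} {σ : Fin m → X} {τ : Fin n → X}
    (h : range σ ⊆ range τ) : tdiam σ ≤ tdiam τ :=
  nndiam_mono h (finite_range τ).isBounded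

theorem tdiam_face_le (τ : Fin (n + 1) → X) (i : Fin (n + 1)) :
    tdiam (τ ∘ i.succAbove) ≤ tdiam τ :=
  tdiam_le_of_range_subset (range_comp_subset_range _ _)

theorem nndist_le_tdiam (τ : Fin n → X) (i j : Fin n) : nndist (τ i) (τ j) ≤ tdiam τ :=
  Metric.dist_le_diam_of_mem (finite_range τ).isBounded (mem_range_self i) (mem_range_self j)

theorem tdiam_le {τ : Fin n → X} {r : ℝ≥0} (h : ∀ i j, nndist (τ i) (τ j) ≤ r) : tdiam τ ≤ r := by
  refine Metric.diam_le_of_forall_dist_le r.2 ?_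
  rintro _ ⟨i, rfl⟩ _ ⟨j, rfl⟩
  exact h i j

/-- The neighborhood of a tuple of radius `radius ρ k` evaluated at the diameter. -/
def reach (ρ : ℝ≥0 → ℝ≥0) (k : ℕ) (τ : Fin n → X) : Set X := nhd τ (radius ρ k (tdiam τ))

theorem nhd_mono {τ : Fin n → X} {a b : ℝ≥0} (h : a ≤ b) : nhd τ a ⊆ nhd τ b :=
  fun _ ⟨i, hi⟩ => ⟨i, hi.trans h⟩

theorem nhd_face_subset (τ : Fin (n + 1) → X) (i : Fin (n + 1)) (a : ℝ≥0) :
    nhd (τ ∘ i.succAbove) a ⊆ nhd τ a := fun _ ⟨_, hj⟩ => ⟨_, hj⟩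

theorem mem_nhd (τ : Fin n → X) (a : ℝ≥0) (i : Fin n) : τ i ∈ nhd τ a := ⟨i, by simp⟩

theorem reach_mono (hρ : Monotone ρ) {k l : ℕ} (h : k ≤ l) (τ : Fin n → X) :
    reach ρ k τ ⊆ reach ρ l τ := nhd_mono (radius_mono hρ h le_rfl)

theorem reach_face_subset (hρ : Monotone ρ) (k : ℕ) (τ : Fin (n + 1) → X) (i : Fin (n + 1)) :
    reach ρ k (τ ∘ i.succAbove) ⊆ reach ρ k τ :=
  (nhd_face_subset τ i _).trans (nhd_mono (radius_mono hρ le_rfl (tdiam_face_le τ i)))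

/-- Every vertex of the tuple is at distance greater than `m (diam τ)` from `b`. -/
def far (b : X) (m : ℝ≥0 → ℝ≥0) (n : ℕ) : Set (Fin n → X) :=
  {τ | ∀ i, m (tdiam τ) < nndist b (τ i)}

theorem far_weaken {b : X} {m m' : ℝ≥0 → ℝ≥0} (h : ∀ d, m' d ≤ m d) {τ : Fin n → X}
    (hτ : τ ∈ far b m n) : τ ∈ far b m' n := fun i => (h _).trans_lt (hτ i)

theorem far_face {b : X} {m m' : ℝ≥0 → ℝ≥0} (h : ∀ d e, d ≤ e → m' d ≤ m e)
    {τ : Fin (n + 1) → X} (hτ : τ ∈ far b m (n + 1)) (i : Fin (n + 1)) :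
    τ ∘ i.succAbove ∈ far b m' n :=
  fun j => (h _ _ (tdiam_face_le τ i)).trans_lt (hτ (i.succAbove j))

theorem isFar_iff {b : X} {m : ℝ≥0 → ℝ≥0} {τ : Fin (n + 1) → X} :
    IsFar b m τ ↔ τ ∈ far b m (n + 1) := by
  have hr : (range τ).Nonempty := range_nonempty τ
  constructor
  · intro h i
    refine lt_of_lt_of_le h ?_
    rw [← NNReal.coe_le_coe]
    exact Metric.infDist_le_dist_of_mem (mem_range_self i)
  · intro h
    obtain ⟨_, ⟨i, rfl⟩, hi⟩ := (finite_range τ).isCompact.exists_infDist_eq_dist hr b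
    have h1 : Metric.infNndist b (range τ) = nndist b (τ i) := NNReal.coe_injective hi
    rw [IsFar, h1]
    exact h i

/-- Far-out sets are contractible in a controlled way. -/
def FarContractible (b : X) (ρ μ : ℝ≥0 → ℝ≥0) : Prop :=
  ∀ (B : Set X) (r : ℝ≥0), B.Nonempty → (∀ x ∈ B, ∀ y ∈ B, nndist x y ≤ r) →
    (∀ x ∈ B, μ r ≤ nndist b x) →
    ∃ (H : ℝ → X → X) (c : X), Contracts H B c {y | ∀ x ∈ B, nndist y x ≤ ρ r}

/-- Changing the basepoint costs its displacement in `μ`. Monotonicity allows an upper bound `r` in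
place of the exact diameter. -/
theorem UniformlyContractibleAtInfinity.farContractible
    (h : UniformlyContractibleAtInfinity X) (b : X) :
    ∃ ρ μ : ℝ≥0 → ℝ≥0, Monotone ρ ∧ Monotone μ ∧ FarContractible b ρ μ := by
  classical
  obtain ⟨b₀, ρ, μ, hρ, hμ, h⟩ := h
  refine ⟨ρ, fun r => μ r + nndist b b₀, hρ, fun r s hrs => add_le_add_left (hμ hrs) _, ?_⟩
  intro B r hB hd hb
  have hbdd : Bornology.IsBounded B := Metric.isBounded_iff.2 ⟨r, fun x hx y hy => hd x hx y hy⟩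
  have hr : nndiam B ≤ r := Metric.diam_le_of_forall_dist_le r.2 fun x hx y hy => hd x hx y hy
  have hinf : μ (nndiam B) ≤ Metric.infNndist b₀ B := by
    rw [← NNReal.coe_le_coe, Metric.coe_infNndist, Metric.le_infDist hB]
    intro x hx
    have h1 : μ r + nndist b b₀ ≤ nndist b x := hb x hx
    have h2 : nndist b x ≤ nndist b b₀ + nndist b₀ x := nndist_triangle b b₀ x
    have h3 : μ r ≤ nndist b₀ x := by
      rw [add_comm] at h1
      exact le_of_add_le_add_left (h1.trans h2)
    exact NNReal.coe_le_coe.2 ((hμ hr).trans h3)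
  obtain ⟨C, hCb, hCd, hBC, ⟨c, ⟨F⟩⟩⟩ := h B hB hbdd hinf
  have hC : ∀ y ∈ C, ∀ x ∈ B, nndist y x ≤ ρ r := fun y hy x hx =>
    ((Metric.dist_le_diam_of_mem hCb hy (hBC hx) : nndist y x ≤ nndiam C).trans hCd).trans (hρ hr)
  -- The homotopy is made total by clamping time to the unit interval and fixing points outside `B`.
  refine ⟨fun t y => if hy : y ∈ B then (F (projIcc 0 1 zero_le_one t, ⟨y, hy⟩) : C) else y, c,
    ?_, ?_, ?_, ?_, ?_⟩
  · rw [continuousOn_iff_continuous_domRestrict]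
    have : Continuous fun p : (Icc (0 : ℝ) 1 ×ˢ B : Set (ℝ × X)) =>
        ((F (projIcc 0 1 zero_le_one p.1.1, ⟨p.1.2, p.2.2⟩) : C) : X) := by
      refine continuous_subtype_val.comp (F.continuous.comp (Continuous.prodMk ?_ ?_))
      · exact continuous_projIcc.comp (continuous_fst.comp continuous_subtype_val)
      · exact Continuous.subtype_mk (continuous_snd.comp continuous_subtype_val) _
    refine this.congr fun p => ?_
    simp [p.2.2]
  · intro y hy
    simp only [hy, dite_true, projIcc_left]
    exact congrArg Subtype.val (F.apply_zero ⟨y, hy⟩)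
  · intro y hy
    simp only [hy, dite_true, projIcc_right]
    exact congrArg Subtype.val (F.apply_one ⟨y, hy⟩)
  · intro t _ y hy
    simp only [hy, dite_true]
    exact hC _ (Subtype.coe_prop _)
  · exact hC _ c.2

/-- Points of the neighborhood may be closer to `b` than the tuple by its radius, which is the
second summand of `threshold`. -/
theorem FarContractible.exists_contracts_reach {b : X} (h : FarContractible b ρ μ) (k : ℕ)
    {τ : Fin (n + 1) → X} (hτ : τ ∈ far b (threshold ρ μ k) (n + 1)) :
    ∃ H c, Contracts H (reach ρ k τ) c (reach ρ (k + 1) τ) := by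
  have hd : ∀ x ∈ reach ρ k τ, ∀ y ∈ reach ρ k τ,
      nndist x y ≤ tdiam τ + 2 * radius ρ k (tdiam τ) := by
    rintro x ⟨i, hi⟩ y ⟨j, hj⟩
    have h1 : nndist x y ≤ nndist x (τ i) + nndist (τ i) (τ j) + nndist (τ j) y :=
      dist_triangle4 x (τ i) (τ j) y
    have h2 := nndist_le_tdiam τ i j
    rw [nndist_comm y] at hj
    calc _ ≤ _ := h1
      _ ≤ radius ρ k (tdiam τ) + tdiam τ + radius ρ k (tdiam τ) := by gcongr
      _ = _ := by ring
  have hb : ∀ x ∈ reach ρ k τ, μ (tdiam τ + 2 * radius ρ k (tdiam τ)) ≤ nndist b x := by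
    rintro x ⟨i, hi⟩
    have h1 := (hτ i).le
    have h2 := nndist_triangle b x (τ i)
    exact le_of_add_le_add_right ((h1.trans h2).trans (add_le_add_right hi _))
  obtain ⟨H, c, hH⟩ := h _ _ ⟨τ 0, mem_nhd _ _ _⟩ hd hb
  have hD : {y | ∀ x ∈ reach ρ k τ, nndist y x ≤ ρ (tdiam τ + 2 * radius ρ k (tdiam τ))} ⊆
      reach ρ (k + 1) τ := fun y hy => ⟨0, (hy _ (mem_nhd _ _ _)).trans (by
        rw [radius, add_right_comm]; exact le_add_self)⟩
  exact ⟨H, c, hH.cont, hH.zero, hH.one, fun t ht y hy => hD (hH.mem t ht y hy),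
    hD hH.center_mem⟩

end Radii

/-! ### Chain maps to sequences of chains -/

section Systems

open Set Filter

variable {R : Type*} [Ring R] {X : Type*} [MetricSpace X] {ρ μ : ℝ≥0 → ℝ≥0} {b : X}

theorem far_threshold_face (hρ : Monotone ρ) (hμ : Monotone μ) {k l n : ℕ} (h : k ≤ l)
    {τ : Fin (n + 1) → X} (hτ : τ ∈ far b (threshold ρ μ l) (n + 1)) (i : Fin (n + 1)) :
    τ ∘ i.succAbove ∈ far b (threshold ρ μ k) n :=
  far_face (fun _ _ hde => threshold_mono hρ hμ h hde) hτ i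

theorem far_threshold_weaken (hρ : Monotone ρ) (hμ : Monotone μ) {k l n : ℕ} (h : k ≤ l)
    {τ : Fin n → X} (hτ : τ ∈ far b (threshold ρ μ l) n) : τ ∈ far b (threshold ρ μ k) n :=
  far_weaken (fun _ => threshold_mono hρ hμ h le_rfl) hτ

theorem map_bd_tup_mem_ctl (hρ : Monotone ρ) {m k n : ℕ} (f : Tup R X n →ₗ[R] (ℕ → Tup R X m))
    {τ : Fin (n + 1) → X}
    (h : ∀ i : Fin (n + 1), f (tup R (τ ∘ i.succAbove)) ∈ ctl R m (reach ρ k (τ ∘ i.succAbove))) :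
    f (bd R X n (tup R τ)) ∈ ctl R m (reach ρ k τ) := by
  rw [bd_tup, map_sum]
  refine Submodule.sum_mem _ fun i _ => ?_
  rw [map_smul]
  exact Submodule.smul_mem _ _ (ctl_mono (reach_face_subset hρ k τ i) (h i))

/-- The inclusion of far-out simplices, up to controlled errors, by chains that become
arbitrarily small. -/
theorem FarContractible.exists_system (hρ : Monotone ρ) (hμ : Monotone μ)
    (hX : FarContractible b ρ μ) :
    ∃ S : ∀ n, Tup R X n →ₗ[R] (ℕ → Tup R X n),
      S 0 = LinearMap.pi (fun _ => LinearMap.id) ∧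
      (∀ n, ∀ τ ∈ far b (threshold ρ μ n) n, S n (tup R τ) ∈ ctl R n (reach ρ n τ)) ∧
      ∀ n, ∀ τ ∈ far b (threshold ρ μ (n + 1)) (n + 1), ∀ j,
        bd R X n (S (n + 1) (tup R τ) j) = S n (bd R X n (tup R τ)) j := by
  obtain ⟨S, h0, hP, hQ⟩ := exists_dependent_seq
    (β := fun n => Tup R X n →ₗ[R] (ℕ → Tup R X n))
    (fun n s => (∀ τ ∈ far b (threshold ρ μ n) n, s (tup R τ) ∈ ctl R n (reach ρ n τ)) ∧
      ∀ τ ∈ far b (threshold ρ μ (n + 1)) (n + 1), ∀ j, IsCyc (s (bd R X n (tup R τ)) j))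
    (fun n s s' => ∀ τ ∈ far b (threshold ρ μ (n + 1)) (n + 1), ∀ j,
        bd R X n (s' (tup R τ) j) = s (bd R X n (tup R τ)) j)
    (LinearMap.pi (fun _ => LinearMap.id))
    (by
      refine ⟨fun τ _ => ⟨⟨∅, empty_subset _, isCompact_empty, fun j => ?_⟩, fun ε _ =>
        Eventually.of_forall fun j => ?_⟩, fun _ _ _ => trivial⟩
      · exact tup_mem_supported fun p => p.elim0
      · exact tup_mem_supported fun p => p.elim0)
    (by
      rintro n s ⟨hs, hc⟩
      obtain ⟨s', hs'⟩ := exists_linear_extension (R := R) (A := far b (threshold ρ μ (n + 1)) (n + 1))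
        (p := fun (τ : Fin (n + 1) → X) (w : ℕ → Tup R X (n + 1)) =>
          w ∈ ctl R (n + 1) (reach ρ (n + 1) τ) ∧ ∀ j, bd R X n (w j) = s (bd R X n (tup R τ)) j)
        (by
          intro τ hτ
          obtain ⟨H, c, hH⟩ := hX.exists_contracts_reach n
            (far_threshold_weaken hρ hμ n.le_succ hτ)
          obtain ⟨w, hw, hw'⟩ := hH.exists_seq_filling (R := R)
            (map_bd_tup_mem_ctl hρ s fun i => hs _ (far_threshold_face hρ hμ n.le_succ hτ i))
            (hc τ hτ)
          exact ⟨w, hw, hw'⟩)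
      refine ⟨s', ⟨fun τ hτ => (hs' τ hτ).1, fun τ hτ j => ?_⟩, fun τ hτ => (hs' τ hτ).2⟩
      -- On the faces of `τ` the relation `∂ s' = s ∂` is known, hence `∂ s' ∂ τ = s ∂ ∂ τ = 0`.
      rw [isCyc_succ]
      have := map_eq_of_supported
        (bd_tup_mem (R := R) (fun i => far_threshold_face hρ hμ (by omega : n + 1 ≤ _) hτ i))
        (bd R X n ∘ₗ LinearMap.proj j ∘ₗ s') (LinearMap.proj j ∘ₗ s ∘ₗ bd R X n)
        (fun σ hσ => by
          simp only [LinearMap.comp_apply, LinearMap.proj_apply]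
          exact (hs' σ hσ).2 j)
      simp only [LinearMap.comp_apply, LinearMap.proj_apply, bd_bd, map_zero] at this
      exact this)
  exact ⟨S, h0, fun n => (hP n).1, hQ⟩

/-- The consecutive stages of a system of chains are homotopic. -/
theorem FarContractible.exists_system_homotopy (hρ : Monotone ρ) (hμ : Monotone μ)
    (hX : FarContractible b ρ μ) {S : ∀ n, Tup R X n →ₗ[R] (ℕ → Tup R X n)}
    (hS0 : S 0 = LinearMap.pi (fun _ => LinearMap.id))
    (hSr : ∀ n, ∀ τ ∈ far b (threshold ρ μ n) n, S n (tup R τ) ∈ ctl R n (reach ρ n τ))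
    (hSb : ∀ n, ∀ τ ∈ far b (threshold ρ μ (n + 1)) (n + 1), ∀ j,
        bd R X n (S (n + 1) (tup R τ) j) = S n (bd R X n (tup R τ)) j) :
    ∃ e : ∀ n, Tup R X n →ₗ[R] (ℕ → Tup R X (n + 1)), e 0 = 0 ∧
      (∀ n, ∀ τ ∈ far b (threshold ρ μ (2 * n)) n,
        e n (tup R τ) ∈ ctl R (n + 1) (reach ρ (2 * n) τ)) ∧
      ∀ n, ∀ τ ∈ far b (threshold ρ μ (2 * (n + 1))) (n + 1), ∀ j,
        bd R X (n + 1) (e (n + 1) (tup R τ) j) =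
          S (n + 1) (tup R τ) j - S (n + 1) (tup R τ) (j + 1) - e n (bd R X n (tup R τ)) j := by
  obtain ⟨e, h0, hP, hQ⟩ := exists_dependent_seq
    (β := fun n => Tup R X n →ₗ[R] (ℕ → Tup R X (n + 1)))
    (fun n s => (∀ τ ∈ far b (threshold ρ μ (2 * n)) n,
        s (tup R τ) ∈ ctl R (n + 1) (reach ρ (2 * n) τ)) ∧
      ∀ τ ∈ far b (threshold ρ μ (2 * (n + 1))) (n + 1), ∀ j,
        bd R X n (S (n + 1) (tup R τ) j - S (n + 1) (tup R τ) (j + 1) -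
          s (bd R X n (tup R τ)) j) = 0)
    (fun n s s' => ∀ τ ∈ far b (threshold ρ μ (2 * (n + 1))) (n + 1), ∀ j,
        bd R X (n + 1) (s' (tup R τ) j) =
          S (n + 1) (tup R τ) j - S (n + 1) (tup R τ) (j + 1) - s (bd R X n (tup R τ)) j)
    0
    (by
      refine ⟨fun τ _ => Submodule.zero_mem _, fun τ hτ j => ?_⟩
      have hτ' := far_threshold_weaken hρ hμ (by omega : 0 + 1 ≤ 2 * (0 + 1)) hτ
      rw [map_sub, map_sub, hSb 0 τ hτ', hSb 0 τ hτ', hS0]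
      simp)
    (by
      rintro n s ⟨hs, hc⟩
      obtain ⟨s', hs'⟩ := exists_linear_extension (R := R)
        (A := far b (threshold ρ μ (2 * (n + 1))) (n + 1))
        (p := fun (τ : Fin (n + 1) → X) (w : ℕ → Tup R X (n + 2)) =>
          w ∈ ctl R (n + 2) (reach ρ (2 * (n + 1)) τ) ∧ ∀ j, bd R X (n + 1) (w j) =
            S (n + 1) (tup R τ) j - S (n + 1) (tup R τ) (j + 1) - s (bd R X n (tup R τ)) j)
        (by
          intro τ hτ
          -- Index `2 * n + 1` accommodates both `S`, of index `n + 1`, and the homotopy on the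
          -- faces, of index `2 * n`; the filling then has index `2 * (n + 1)`.
          obtain ⟨H, c, hH⟩ := hX.exists_contracts_reach (2 * n + 1)
            (far_threshold_weaken hρ hμ (by omega) hτ)
          have hS := ctl_mono (reach_mono hρ (by omega : n + 1 ≤ 2 * n + 1) τ)
            (hSr (n + 1) τ (far_threshold_weaken hρ hμ (by omega) hτ))
          have hsb := ctl_mono (reach_mono hρ (by omega : 2 * n ≤ 2 * n + 1) τ)
            (map_bd_tup_mem_ctl hρ s fun i => hs _ (far_threshold_face hρ hμ (by omega) hτ i))
          obtain ⟨w, hw, hw'⟩ := hH.exists_seq_filling (R := R)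
            (Submodule.sub_mem _ (Submodule.sub_mem _ hS (ctl_shift hS)) hsb) (hc τ hτ)
          exact ⟨w, hw, hw'⟩)
      refine ⟨s', ⟨fun τ hτ => (hs' τ hτ).1, fun τ hτ j => ?_⟩, fun τ hτ => (hs' τ hτ).2⟩
      have := map_eq_of_supported
        (bd_tup_mem (R := R) (fun i => far_threshold_face hρ hμ (by omega : 2 * (n + 1) ≤ _) hτ i))
        (bd R X (n + 1) ∘ₗ LinearMap.proj j ∘ₗ s') (LinearMap.proj j ∘ₗ S (n + 1) -
          LinearMap.proj (j + 1) ∘ₗ S (n + 1) - LinearMap.proj j ∘ₗ s ∘ₗ bd R X n)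
        (fun σ hσ => (hs' σ hσ).2 j)
      simp only [LinearMap.comp_apply, LinearMap.proj_apply, LinearMap.sub_apply, bd_bd, map_zero,
        sub_zero] at this
      have hτ' := far_threshold_weaken hρ hμ (by omega : n + 1 + 1 ≤ 2 * (n + 1 + 1)) hτ
      rw [map_sub, map_sub, hSb _ τ hτ', hSb _ τ hτ', this, sub_self])
  exact ⟨e, h0, fun n => (hP n).1, hQ⟩

end Systems

/-! ### Iterated refinements of a cover along homotopies -/

section Covers

open Set Filter

variable {R : Type*} [Ring R] {X : Type*} [MetricSpace X]

/-- Sets that every stage of a homotopy sends into a member of `𝒱`. -/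
def pull (𝒱 : Set (Set X)) (H : ℝ → X → X) (B : Set X) : Set (Set X) :=
  {O | ∀ t ∈ Icc (0 : ℝ) 1, ∃ V ∈ 𝒱, ∀ y ∈ O ∩ B, H t y ∈ V}

/-- A tube-lemma argument: each time has a neighborhood with a common `O`, and compactness of the
interval leaves finitely many. Off the closed set `B` the condition is vacuous. -/
theorem exists_mem_nhds_pull {𝒱 : Set (Set X)} (ho : ∀ V ∈ 𝒱, IsOpen V) (hc : ⋃₀ 𝒱 = univ)
    {H : ℝ → X → X} {B : Set X} (hB : IsClosed B)
    (hH : ContinuousOn (fun p : ℝ × X => H p.1 p.2) (Icc 0 1 ×ˢ B)) (x : X) :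
    ∃ O ∈ 𝓝 x, O ∈ pull 𝒱 H B := by
  have hne : ∀ y, ∃ V ∈ 𝒱, y ∈ V := fun y => by
    have : y ∈ ⋃₀ 𝒱 := hc ▸ mem_univ y
    exact this
  by_cases hx : x ∈ B
  · refine isCompact_Icc.induction_on (p := fun J : Set ℝ => ∃ O ∈ 𝓝 x, ∀ t ∈ J, ∃ V ∈ 𝒱,
      ∀ y ∈ O ∩ B, H t y ∈ V) ?_ ?_ ?_ ?_
    · exact ⟨univ, univ_mem, fun t ht => ht.elim⟩
    · rintro J J' hJ ⟨O, hO, h⟩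
      exact ⟨O, hO, fun t ht => h t (hJ ht)⟩
    · rintro J J' ⟨O, hO, h⟩ ⟨O', hO', h'⟩
      refine ⟨O ∩ O', inter_mem hO hO', ?_⟩
      rintro t (ht | ht)
      · obtain ⟨V, hV, hy⟩ := h t ht
        exact ⟨V, hV, fun y hyO => hy y ⟨hyO.1.1, hyO.2⟩⟩
      · obtain ⟨V, hV, hy⟩ := h' t ht
        exact ⟨V, hV, fun y hyO => hy y ⟨hyO.1.2, hyO.2⟩⟩
    · intro t ht
      obtain ⟨V, hV, hV'⟩ := hne (H t x)
      have := hH (t, x) ⟨ht, hx⟩ ((ho V hV).mem_nhds hV')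
      rw [Filter.mem_map, nhdsWithin_prod_eq, mem_prod_iff] at this
      obtain ⟨J, hJ, O, hO, hJO⟩ := this
      obtain ⟨O', hO', hO'B⟩ := mem_nhdsWithin_iff_exists_mem_nhds_inter.1 hO
      exact ⟨J, hJ, O', hO', fun s hs => ⟨V, hV, fun y hy =>
        @hJO (s, y) ⟨hs, hO'B hy⟩⟩⟩
  · refine ⟨Bᶜ, hB.isOpen_compl.mem_nhds hx, fun t _ => ?_⟩
    obtain ⟨V, hV, -⟩ := hne x
    exact ⟨V, hV, fun y hy => (hy.1 hy.2).elim⟩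

variable {ι : Type*} {H : ι → ℝ → X → X} {B : ι → Set X} {𝒱 : Set (Set X)}

/-- The iterated refinement of `𝒱` along the homotopies with index in `F`. -/
def cover (𝒱 : Set (Set X)) (H : ι → ℝ → X → X) (B : ι → Set X) (F : Set ι) : ℕ → Set (Set X)
  | 0 => 𝒱
  -- A filling along one of the homotopies turns chains subordinate to stage `j + 1` into chains
  -- subordinate to stage `j`.
  | j + 1 => {O | IsOpen O ∧ (∃ V ∈ cover 𝒱 H B F j, O ⊆ V) ∧
      ∀ h ∈ F, O ∈ pull (cover 𝒱 H B F j) (H h) (B h)}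

theorem cover_antitone {F F' : Set ι} (h : F ⊆ F') (j : ℕ) :
    cover 𝒱 H B F' j ⊆ cover 𝒱 H B F j := by
  induction j with
  | zero => exact subset_rfl
  | succ j ih =>
    rintro O ⟨hO, ⟨V, hV, hOV⟩, hp⟩
    refine ⟨hO, ⟨V, ih hV, hOV⟩, fun k hk t ht => ?_⟩
    obtain ⟨V', hV', hy⟩ := hp k (h hk) t ht
    exact ⟨V', ih hV', hy⟩

theorem exists_cover_superset {F : Set ι} {j k : ℕ} (hjk : j ≤ k) {O : Set X}
    (hO : O ∈ cover 𝒱 H B F k) : ∃ V ∈ cover 𝒱 H B F j, O ⊆ V := by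
  induction k, hjk using Nat.le_induction generalizing O with
  | base => exact ⟨O, hO, subset_rfl⟩
  | succ k _ ih =>
    obtain ⟨-, ⟨V, hV, hOV⟩, -⟩ := hO
    obtain ⟨V', hV', h⟩ := ih hV
    exact ⟨V', hV', hOV.trans h⟩

theorem isOpen_of_mem_cover (ho : ∀ V ∈ 𝒱, IsOpen V) {F : Set ι} {j : ℕ} :
    ∀ O ∈ cover 𝒱 H B F j, IsOpen O := by
  cases j with
  | zero => exact ho
  | succ j => exact fun O hO => hO.1

/-- Finiteness of `F` permits intersecting the neighborhoods obtained for the individual homotopies.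
-/
theorem sUnion_cover (ho : ∀ V ∈ 𝒱, IsOpen V) (hc : ⋃₀ 𝒱 = univ) {F : Set ι} (hF : F.Finite)
    (hB : ∀ h ∈ F, IsClosed (B h))
    (hH : ∀ h ∈ F, ContinuousOn (fun p : ℝ × X => H h p.1 p.2) (Icc 0 1 ×ˢ B h)) (j : ℕ) :
    ⋃₀ cover 𝒱 H B F j = univ := by
  induction j with
  | zero => exact hc
  | succ j ih =>
    refine eq_univ_of_forall fun x => ?_
    have hx : x ∈ ⋃₀ cover 𝒱 H B F j := ih ▸ mem_univ x
    obtain ⟨V, hV, hxV⟩ := hx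
    choose! O hO hOp using fun h (hh : h ∈ F) =>
      exists_mem_nhds_pull (isOpen_of_mem_cover ho (F := F) (j := j)) ih (hB h hh) (hH h hh) x
    have : V ∩ ⋂ h ∈ F, O h ∈ 𝓝 x :=
      inter_mem ((isOpen_of_mem_cover ho V hV).mem_nhds hxV) ((biInter_mem hF).2 hO)
    obtain ⟨U, hU, hUo, hxU⟩ := mem_nhds_iff.1 this
    refine ⟨U, ⟨hUo, ⟨V, hV, fun y hy => (hU hy).1⟩, fun h hh t ht => ?_⟩, hxU⟩
    obtain ⟨V', hV', hy⟩ := hOp h hh t ht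
    exact ⟨V', hV', fun y hyU => hy y ⟨mem_iInter₂.1 (hU hyU.1).2 h hh, hyU.2⟩⟩

theorem smallTup_of_forall {Y : Type*} {𝒱 𝒲 : Set (Set Y)} (h : ∀ O ∈ 𝒱, ∃ V ∈ 𝒲, O ⊆ V)
    {n : ℕ} {τ : Fin n → Y} (hτ : τ ∈ smallTup 𝒱 n) : τ ∈ smallTup 𝒲 n := by
  obtain ⟨O, hO, hp⟩ := hτ
  obtain ⟨V, hV, hOV⟩ := h O hO
  exact ⟨V, hV, fun p => hOV (hp p)⟩

/-- At each time the moved tuple lies in some `V`, hence in the same `V` at nearby times. A Lebesgue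
number for this cover of the time interval puts both ends of a short step into one `V`, and so the
whole prism. -/
theorem Contracts.eventually_small_steps {H : ℝ → X → X} {B : Set X} {c : X} {D : Set X}
    (hH : Contracts H B c D) {𝒱 : Set (Set X)} (ho : ∀ V ∈ 𝒱, IsOpen V) {n : ℕ}
    {τ : Fin n → X} (hτB : ∀ p, τ p ∈ B) (hτ : τ ∈ smallTup (pull 𝒱 H B) n) :
    ∀ᶠ m : ℕ in atTop, ∀ k < m, ∃ V ∈ 𝒱, ∀ p,
      H ((k : ℝ) / m) (τ p) ∈ V ∧ H (((k + 1 : ℕ) : ℝ) / m) (τ p) ∈ V := by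
  obtain ⟨O, hO, hp⟩ := hτ
  have hg : ∀ p, Continuous fun t : ℝ => H (projIcc 0 1 zero_le_one t : ℝ) (τ p) := fun p =>
    hH.cont.comp_continuous (f := fun t : ℝ => ((projIcc 0 1 zero_le_one t : ℝ), τ p))
      (by fun_prop) fun t => ⟨Subtype.coe_prop _, hτB p⟩
  obtain ⟨δ, hδ, hδ'⟩ := lebesgue_number_lemma_of_metric (isCompact_Icc (a := (0 : ℝ)) (b := 1))
    (c := fun V : 𝒱 => {t : ℝ | ∀ p, H (projIcc 0 1 zero_le_one t : ℝ) (τ p) ∈ (V : Set X)})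
    (fun V => by
      simp only [ofPred_forall]
      exact isOpen_iInter_of_finite fun p => (ho V V.2).preimage (hg p))
    (fun t ht => by
      obtain ⟨V, hV, h⟩ := hO t ht
      refine mem_iUnion.2 ⟨⟨V, hV⟩, fun p => ?_⟩
      rw [projIcc_of_mem _ ht]
      exact h _ ⟨hp p, hτB p⟩)
  obtain ⟨M, hM⟩ := exists_nat_one_div_lt hδ
  filter_upwards [eventually_ge_atTop (M + 1)] with m hm k hk
  have hm0 : (0 : ℝ) < m := by exact_mod_cast (Nat.succ_pos M).trans_le hm
  have hI : ∀ l : ℕ, l ≤ m → (l : ℝ) / m ∈ Icc (0 : ℝ) 1 := fun l hl =>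
    ⟨by positivity, by rw [div_le_one hm0]; exact_mod_cast hl⟩
  obtain ⟨V, hV⟩ := hδ' _ (hI k hk.le)
  have h1 := hV (Metric.mem_ball_self hδ)
  have h2 : ((k + 1 : ℕ) : ℝ) / m ∈ Metric.ball ((k : ℝ) / m) δ := by
    rw [Metric.mem_ball, Real.dist_eq, ← sub_div]
    push_cast
    rw [add_sub_cancel_left, abs_of_pos (by positivity)]
    refine lt_of_le_of_lt ?_ hM
    exact one_div_le_one_div_of_le (by positivity) (by exact_mod_cast hm)
  have h2 := hV h2
  refine ⟨V, V.2, fun p => ⟨?_, ?_⟩⟩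
  · have := h1 p
    rwa [projIcc_of_mem _ (hI k hk.le)] at this
  · have := h2 p
    rwa [projIcc_of_mem _ (hI (k + 1) hk)] at this

/-- The support is finite, so one number of time steps works for all its tuples. -/
theorem Contracts.exists_small_filling {H : ℝ → X → X} {B : Set X} {c : X} {D : Set X}
    (hH : Contracts H B c D) {𝒱 : Set (Set X)} (ho : ∀ V ∈ 𝒱, IsOpen V) (hc : ⋃₀ 𝒱 = univ)
    {n : ℕ} {z : Tup R X n} (hz : IsCyc z)
    (hzs : z ∈ Finsupp.supported R R ({τ | ∀ p, τ p ∈ B} ∩ smallTup (pull 𝒱 H B) n)) :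
    ∃ w : Tup R X (n + 1), bd R X n w = z ∧
      w ∈ Finsupp.supported R R ({τ | ∀ p, τ p ∈ D} ∩ smallTup 𝒱 (n + 1)) := by
  rw [Finsupp.mem_supported] at hzs
  have hev : ∀ᶠ m : ℕ in atTop, ∀ τ ∈ z.support, ∀ k < m, ∃ V ∈ 𝒱, ∀ p,
      H ((k : ℝ) / m) (τ p) ∈ V ∧ H (((k + 1 : ℕ) : ℝ) / m) (τ p) ∈ V :=
    (Filter.eventually_all_finset _).2 fun τ hτ =>
      hH.eventually_small_steps ho (hzs hτ).1 (hzs hτ).2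
  obtain ⟨m, hm, hm1⟩ := (hev.and (eventually_ge_atTop 1)).exists
  have hm0 : (0 : ℝ) < m := by exact_mod_cast hm1
  have hI : ∀ l : ℕ, l ≤ m → (l : ℝ) / m ∈ Icc (0 : ℝ) 1 := fun l hl =>
    ⟨by positivity, by rw [div_le_one hm0]; exact_mod_cast hl⟩
  refine exists_filling (fun k => H ((k : ℝ) / m)) m c hz (s := z.support)
    (by simp [Finsupp.mem_supported]) ?_ ?_ ?_ ?_
  · intro τ hτ i
    simpa using hH.zero _ ((hzs hτ).1 i)
  · intro τ hτ i
    simpa [div_self hm0.ne'] using hH.one _ ((hzs hτ).1 i)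
  · have : c ∈ ⋃₀ 𝒱 := hc ▸ mem_univ c
    obtain ⟨V, hV, hcV⟩ := this
    exact ⟨fun _ => hH.center_mem, V, hV, fun _ => hcV⟩
  · intro τ hτ k hk υ hυ
    obtain ⟨V, hV, hVp⟩ := hm τ hτ k hk
    refine ⟨fun i => ?_, V, hV, fun i => ?_⟩
    · obtain ⟨p, hp | hp⟩ := hυ i <;> rw [hp]
      · exact hH.mem _ (hI k hk.le) _ ((hzs hτ).1 p)
      · exact hH.mem _ (hI (k + 1) hk) _ ((hzs hτ).1 p)
    · obtain ⟨p, hp | hp⟩ := hυ i <;> rw [hp]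
      · exact (hVp p).1
      · exact (hVp p).2

end Covers

/-! ### Small simplices -/

section Small

open Set Filter

variable {R : Type*} [Ring R] {X : Type*} [MetricSpace X]

/-- The distance from the basepoint beyond which small tuples of length `n` are handled. -/
def smallThreshold (ρ μ : ℝ≥0 → ℝ≥0) (n : ℕ) : ℝ≥0 := threshold ρ μ (3 * n) 2 + 1 + n

/-- The ball around `h.1` on which small tuples of length `h.2` are contracted. -/
def smallBall (ρ : ℝ≥0 → ℝ≥0) (h : X × ℕ) : Set X :=
  Metric.closedBall h.1 (radius ρ (3 * h.2) 2 + 1 : ℝ≥0)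

/-- The indices of the homotopies that concern a set. -/
def indices (b : X) (ρ μ : ℝ≥0 → ℝ≥0) (W : X → Set X) (s : Set X) : Set (X × ℕ) :=
  {h | s ⊆ W h.1 ∧ smallThreshold ρ μ h.2 < nndist b h.1}

/-- The largest length among a set of indices. -/
def level {Y : Type*} (F : Set (Y × ℕ)) : ℕ := sSup (Prod.snd '' F)

/-- The cover to which chains associated with the set `s` are subordinate. -/
def fineCover (b : X) (ρ μ : ℝ≥0 → ℝ≥0) (W : X → Set X) (H : X × ℕ → ℝ → X → X)
    (𝒱 : Set (Set X)) (s : Set X) : Set (Set X) :=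
  -- Each tuple length uses up one stage, and `level` is the largest length for which there are
  -- homotopies around `s`.
  cover 𝒱 H (smallBall ρ) (indices b ρ μ W s) (level (indices b ρ μ W s))

/-- The small tuples. -/
def small (b : X) (ρ μ : ℝ≥0 → ℝ≥0) (W : X → Set X) (H : X × ℕ → ℝ → X → X)
    (𝒱 : Set (Set X)) (n : ℕ) : Set (Fin n → X) :=
  {τ | (∃ α, (α, n) ∈ indices b ρ μ W (range τ)) ∧
    -- Asking this of all subsets makes smallness hereditary; it would not follow from `s = range
    -- τ`, because the cover attached to a smaller set is finer.
    ∀ s ⊆ range τ, s.Nonempty → ∃ V ∈ fineCover b ρ μ W H 𝒱 s, s ⊆ V}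

variable {b : X} {ρ μ : ℝ≥0 → ℝ≥0} {W : X → Set X} {H : X × ℕ → ℝ → X → X} {𝒱 : Set (Set X)}

theorem smallThreshold_mono (hρ : Monotone ρ) (hμ : Monotone μ) :
    Monotone (smallThreshold ρ μ) := fun m n h => by
  have h1 : threshold ρ μ (3 * m) 2 ≤ threshold ρ μ (3 * n) 2 :=
    threshold_mono hρ hμ (by omega) le_rfl
  have h2 : (m : ℝ≥0) ≤ n := by exact_mod_cast h
  exact add_le_add (add_le_add_left h1 1) h2

theorem indices_antitone {s t : Set X} (h : s ⊆ t) :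
    indices b ρ μ W t ⊆ indices b ρ μ W s := fun _ hk => ⟨h.trans hk.1, hk.2⟩

/-- The summand `n` in `smallThreshold` bounds the lengths occurring at `α` by the distance from `b`
to `α`. -/
theorem finite_setOf_smallThreshold_lt {A : Set X} (hA : A.Finite) :
    {h : X × ℕ | h.1 ∈ A ∧ smallThreshold ρ μ h.2 < nndist b h.1}.Finite := by
  refine (hA.biUnion fun α _ =>
    (finite_singleton α).prod (finite_Iio ⌈nndist b α⌉₊)).subset ?_
  rintro ⟨α, n⟩ ⟨hα, hn⟩
  refine mem_biUnion hα ⟨rfl, Nat.lt_ceil.2 (lt_of_le_of_lt ?_ hn)⟩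
  exact le_add_self

theorem finite_indices (hW : LocallyFinite W) {s : Set X} (hs : s.Nonempty) :
    (indices b ρ μ W s).Finite := by
  obtain ⟨x, hx⟩ := hs
  exact (finite_setOf_smallThreshold_lt (hW.point_finite x)).subset fun h hh => ⟨hh.1 hx, hh.2⟩

theorem level_mono {Y : Type*} {F F' : Set (Y × ℕ)} (h : F' ⊆ F) (hF : F.Finite) : level F' ≤ level F := by
  rcases F'.eq_empty_or_nonempty with rfl | hne
  · simp [level]
  · exact csSup_le_csSup (hF.image _).bddAbove (hne.image _) (image_mono h)

theorem le_level {Y : Type*} {F : Set (Y × ℕ)} (hF : F.Finite) {h : Y × ℕ} (hh : h ∈ F) : h.2 ≤ level F :=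
  le_csSup (hF.image _).bddAbove (mem_image_of_mem _ hh)

theorem exists_fineCover_superset {s : Set X} {F : Set (X × ℕ)} (hF : F.Finite)
    (h : indices b ρ μ W s ⊆ F) {O : Set X} (hO : O ∈ cover 𝒱 H (smallBall ρ) F (level F)) :
    ∃ V ∈ fineCover b ρ μ W H 𝒱 s, O ⊆ V :=
  exists_cover_superset (level_mono h hF) (cover_antitone h _ hO)

/-- A larger set has fewer indices and a lower level, so chains fine enough for a face are fine
enough for the simplex. -/
theorem exists_fineCover_superset_of_subset (hW : LocallyFinite W) {s t : Set X}
    (hs : s.Nonempty) (hst : s ⊆ t) {O : Set X} (hO : O ∈ fineCover b ρ μ W H 𝒱 s) :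
    ∃ V ∈ fineCover b ρ μ W H 𝒱 t, O ⊆ V :=
  exists_fineCover_superset (finite_indices hW hs) (indices_antitone hst) hO

theorem small_face (hρ : Monotone ρ) (hμ : Monotone μ) {n : ℕ} {τ : Fin (n + 1) → X}
    (hτ : τ ∈ small b ρ μ W H 𝒱 (n + 1)) (i : Fin (n + 1)) :
    τ ∘ i.succAbove ∈ small b ρ μ W H 𝒱 n := by
  obtain ⟨⟨α, hα⟩, h⟩ := hτ
  have hr : range (τ ∘ i.succAbove) ⊆ range τ := range_comp_subset_range _ _
  exact ⟨⟨α, hr.trans hα.1, (smallThreshold_mono hρ hμ n.le_succ).trans_lt hα.2⟩,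
    fun s hs hne => h s (hs.trans hr) hne⟩

theorem nndist_le_of_mem_indices (hW1 : ∀ α, W α ⊆ Metric.ball α 1) {n : ℕ} {τ : Fin n → X}
    {h : X × ℕ} (hh : h ∈ indices b ρ μ W (range τ)) (i : Fin n) : nndist (τ i) h.1 ≤ 1 :=
  (Metric.mem_ball.1 (hW1 _ (hh.1 (mem_range_self i)))).le

theorem tdiam_le_of_mem_indices (hW1 : ∀ α, W α ⊆ Metric.ball α 1) {n : ℕ} {τ : Fin n → X}
    {h : X × ℕ} (hh : h ∈ indices b ρ μ W (range τ)) : tdiam τ ≤ 2 := by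
  refine tdiam_le fun i j => ?_
  have h1 := nndist_le_of_mem_indices hW1 hh i
  have h2 := nndist_le_of_mem_indices hW1 hh j
  have h3 := nndist_triangle_right (τ i) (τ j) h.1
  calc _ ≤ _ := h3
    _ ≤ 1 + 1 := add_le_add h1 h2
    _ = 2 := by norm_num

theorem far_of_small (hρ : Monotone ρ) (hμ : Monotone μ) (hW1 : ∀ α, W α ⊆ Metric.ball α 1)
    {n : ℕ} {τ : Fin n → X} (hτ : τ ∈ small b ρ μ W H 𝒱 n) :
    τ ∈ far b (threshold ρ μ (2 * n)) n := by
  obtain ⟨⟨α, hα⟩, -⟩ := hτ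
  intro i
  have h1 : threshold ρ μ (2 * n) (tdiam τ) ≤ threshold ρ μ (3 * n) 2 :=
    threshold_mono hρ hμ (by omega) (tdiam_le_of_mem_indices hW1 hα)
  have h2 := nndist_le_of_mem_indices hW1 hα i
  have h3 := nndist_triangle b (τ i) α
  have h4 := hα.2
  have h5 : threshold ρ μ (3 * n) 2 + 1 < nndist b (τ i) + 1 :=
    calc _ ≤ smallThreshold ρ μ n := le_self_add
      _ < nndist b α := h4
      _ ≤ _ := h3
      _ ≤ _ := add_le_add_right h2 _
  exact h1.trans_lt (lt_of_add_lt_add_right h5)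

/-- The homotopies contract the balls around far-out points. -/
def ContractsSmallBalls (b : X) (ρ μ : ℝ≥0 → ℝ≥0) (H : X × ℕ → ℝ → X → X) (c : X × ℕ → X) :
    Prop :=
  ∀ h : X × ℕ, smallThreshold ρ μ h.2 < nndist b h.1 → Contracts (H h) (smallBall ρ h) (c h)
    {y | ∀ x ∈ smallBall ρ h, nndist y x ≤ ρ (2 * (radius ρ (3 * h.2) 2 + 1))}

/-- The ball has diameter at most `2 * (radius + 1) = 2 + 2 * radius`, which is the argument of `μ`
in `threshold` at diameter 2. -/
theorem FarContractible.exists_contractsSmallBalls (hX : FarContractible b ρ μ) :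
    ∃ H c, ContractsSmallBalls b ρ μ H c := by
  have : ∀ h : X × ℕ, ∃ Hc : (ℝ → X → X) × X, smallThreshold ρ μ h.2 < nndist b h.1 →
      Contracts Hc.1 (smallBall ρ h) Hc.2
        {y | ∀ x ∈ smallBall ρ h, nndist y x ≤ ρ (2 * (radius ρ (3 * h.2) 2 + 1))} := by
    intro h
    by_cases hh : smallThreshold ρ μ h.2 < nndist b h.1
    · have hd : ∀ x ∈ smallBall ρ h, ∀ y ∈ smallBall ρ h,
          nndist x y ≤ 2 * (radius ρ (3 * h.2) 2 + 1) := by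
        intro x hx y hy
        have h1 : nndist x h.1 ≤ radius ρ (3 * h.2) 2 + 1 := hx
        have h2 : nndist y h.1 ≤ radius ρ (3 * h.2) 2 + 1 := hy
        rw [two_mul]
        exact (nndist_triangle_right x y h.1).trans (add_le_add h1 h2)
      have hb : ∀ x ∈ smallBall ρ h, μ (2 * (radius ρ (3 * h.2) 2 + 1)) ≤ nndist b x := by
        intro x hx
        have h1 : nndist x h.1 ≤ radius ρ (3 * h.2) 2 + 1 := hx
        have h2 := nndist_triangle b x h.1
        have h3 : threshold ρ μ (3 * h.2) 2 + 1 ≤ smallThreshold ρ μ h.2 := le_self_add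
        have h4 : threshold ρ μ (3 * h.2) 2 + 1 =
            μ (2 * (radius ρ (3 * h.2) 2 + 1)) + (radius ρ (3 * h.2) 2 + 1) := by
          rw [threshold, add_assoc, mul_add, mul_one, add_comm (2 : ℝ≥0)]
        refine le_of_add_le_add_right (a := radius ρ (3 * h.2) 2 + 1) ?_
        calc _ = _ := h4.symm
          _ ≤ _ := h3
          _ ≤ _ := hh.le
          _ ≤ _ := h2
          _ ≤ _ := add_le_add_right h1 _
      obtain ⟨H, c, hH⟩ := hX _ _ ⟨h.1, Metric.mem_closedBall_self NNReal.zero_le_coe⟩ hd hb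
      exact ⟨(H, c), fun _ => hH⟩
    · exact ⟨(fun _ y => y, h.1), fun h' => (hh h').elim⟩
  choose Hc hHc using this
  exact ⟨fun h => (Hc h).1, fun h => (Hc h).2, hHc⟩

theorem ContractsSmallBalls.fineCover_isOpenCover {c : X × ℕ → X}
    (hH : ContractsSmallBalls b ρ μ H c) (ho : ∀ V ∈ 𝒱, IsOpen V) (hc : ⋃₀ 𝒱 = univ)
    {F : Set (X × ℕ)} (hF : F.Finite) (hF' : ∀ h ∈ F, smallThreshold ρ μ h.2 < nndist b h.1)
    (j : ℕ) : ⋃₀ cover 𝒱 H (smallBall ρ) F j = univ :=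
  sUnion_cover ho hc hF (fun _ _ => Metric.isClosed_closedBall)
    (fun h hh => (hH h (hF' h hh)).cont) j

/-- A chain map subordinate to the fine covers is homotopic to the identity on small tuples. -/
theorem ContractsSmallBalls.exists_small_homotopy {c : X × ℕ → X}
    (hH : ContractsSmallBalls b ρ μ H c) (hρ : Monotone ρ) (hμ : Monotone μ)
    (ho : ∀ V ∈ 𝒱, IsOpen V) (hc : ⋃₀ 𝒱 = univ) (hW : LocallyFinite W)
    (hW1 : ∀ α, W α ⊆ Metric.ball α 1) {S : ∀ n, Tup R X n →ₗ[R] Tup R X n}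
    (hS0 : S 0 = LinearMap.id)
    (hSb : ∀ n, ∀ τ ∈ far b (threshold ρ μ (2 * (n + 1))) (n + 1),
      bd R X n (S (n + 1) (tup R τ)) = S n (bd R X n (tup R τ)))
    (hSs : ∀ n, ∀ τ ∈ far b (threshold ρ μ (2 * (n + 1))) (n + 1), S (n + 1) (tup R τ) ∈
      Finsupp.supported R R ({υ | ∀ p, υ p ∈ reach ρ (2 * (n + 1)) τ} ∩
        smallTup (fineCover b ρ μ W H 𝒱 (range τ)) (n + 1))) :
    ∃ T : ∀ n, Tup R X n →ₗ[R] Tup R X (n + 1), T 0 = 0 ∧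
      (∀ n, ∀ τ ∈ small b ρ μ W H 𝒱 n, T n (tup R τ) ∈ Finsupp.supported R R
        ({υ | ∀ p, υ p ∈ nhd τ (radius ρ (3 * n + 1) 2)} ∩ smallTup 𝒱 (n + 1))) ∧
      ∀ n, ∀ τ ∈ small b ρ μ W H 𝒱 (n + 1), bd R X (n + 1) (T (n + 1) (tup R τ)) =
        S (n + 1) (tup R τ) - tup R τ - T n (bd R X n (tup R τ)) := by
  -- In length `n`, `n` of the available stages have been spent.
  let P : ∀ n, (Fin n → X) → Set (Fin (n + 1) → X) := fun n τ =>
    {υ | ∀ p, υ p ∈ nhd τ (radius ρ (3 * n + 1) 2)} ∩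
      smallTup (cover 𝒱 H (smallBall ρ) (indices b ρ μ W (range τ))
        (level (indices b ρ μ W (range τ)) - n)) (n + 1)
  obtain ⟨T, h0, hP, hQ⟩ := exists_dependent_seq
    (β := fun n => Tup R X n →ₗ[R] Tup R X (n + 1))
    (fun n s => (n = 0 → s = 0) ∧
      (∀ τ ∈ small b ρ μ W H 𝒱 n, s (tup R τ) ∈ Finsupp.supported R R (P n τ)) ∧
      ∀ τ ∈ small b ρ μ W H 𝒱 (n + 1),
        bd R X n (S (n + 1) (tup R τ) - tup R τ - s (bd R X n (tup R τ))) = 0)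
    (fun n s s' => ∀ τ ∈ small b ρ μ W H 𝒱 (n + 1), bd R X (n + 1) (s' (tup R τ)) =
        S (n + 1) (tup R τ) - tup R τ - s (bd R X n (tup R τ)))
    0
    (by
      refine ⟨fun _ => rfl, fun τ _ => Submodule.zero_mem _, fun τ hτ => ?_⟩
      rw [map_sub, map_sub, hSb 0 τ (far_of_small hρ hμ hW1 hτ), hS0]
      simp)
    (by
      rintro n s ⟨hs0, hs, hc'⟩
      obtain ⟨s', hs'⟩ := exists_linear_extension (R := R)
        (A := small b ρ μ W H 𝒱 (n + 1))
        (p := fun (τ : Fin (n + 1) → X) (w : Tup R X (n + 2)) =>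
          w ∈ Finsupp.supported R R (P (n + 1) τ) ∧ bd R X (n + 1) w =
            S (n + 1) (tup R τ) - tup R τ - s (bd R X n (tup R τ)))
        (by
          intro τ hτ
          have hτf := far_of_small hρ hμ hW1 hτ
          obtain ⟨⟨α, hα⟩, hτs⟩ := id hτ
          set F := indices b ρ μ W (range τ) with hF
          have hFf : F.Finite := finite_indices hW (range_nonempty τ)
          -- Since `(α, n + 1)` is an index, at least one stage is left for this filling.
          have hL : n + 1 ≤ level F := le_level hFf hα
          have hL' : level F - n = level F - (n + 1) + 1 := by omega
          have hd2 := tdiam_le_of_mem_indices hW1 hα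
          have hball : nhd τ (radius ρ (3 * (n + 1)) 2) ⊆ smallBall ρ (α, n + 1) := by
            rintro y ⟨i, hi⟩
            exact (nndist_triangle y (τ i) α).trans
              (add_le_add hi (nndist_le_of_mem_indices hW1 hα i))
          have hD : {y | ∀ x ∈ smallBall ρ (α, n + 1),
              nndist y x ≤ ρ (2 * (radius ρ (3 * (n + 1)) 2 + 1))} ⊆
              nhd τ (radius ρ (3 * (n + 1) + 1) 2) := fun y hy =>
            ⟨0, (hy _ (hball (mem_nhd _ _ _))).trans (by
              rw [radius, mul_add, mul_one, add_comm _ (2 : ℝ≥0), add_right_comm]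
              exact le_add_self)⟩
          have hpull : ∀ υ : Fin (n + 1) → X,
              υ ∈ smallTup (cover 𝒱 H (smallBall ρ) F (level F - n)) (n + 1) →
              υ ∈ smallTup (pull (cover 𝒱 H (smallBall ρ) F (level F - (n + 1)))
                (H (α, n + 1)) (smallBall ρ (α, n + 1))) (n + 1) := by
            rintro υ ⟨O, hO, hυ⟩
            rw [hL'] at hO
            exact ⟨O, hO.2.2 _ hα, hυ⟩
          have hfine : ∀ O ∈ fineCover b ρ μ W H 𝒱 (range τ),
              ∃ V ∈ cover 𝒱 H (smallBall ρ) F (level F - n), O ⊆ V :=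
            fun O hO => exists_cover_superset (Nat.sub_le _ _) hO
          have hz : S (n + 1) (tup R τ) - tup R τ - s (bd R X n (tup R τ)) ∈
              Finsupp.supported R R ({υ : Fin (n + 1) → X | ∀ p, υ p ∈ smallBall ρ (α, n + 1)} ∩
                smallTup (pull (cover 𝒱 H (smallBall ρ) F (level F - (n + 1)))
                (H (α, n + 1)) (smallBall ρ (α, n + 1))) (n + 1)) := by
            refine Submodule.sub_mem _ (Submodule.sub_mem _ ?_ ?_) ?_
            · refine supported_weaken (hSs n τ hτf) fun υ hυ => ⟨fun p => hball ?_,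
                hpull υ (smallTup_of_forall hfine hυ.2)⟩
              exact nhd_mono (radius_mono hρ (by omega) hd2) (hυ.1 p)
            · refine tup_mem_supported ⟨fun p => hball (mem_nhd _ _ _), hpull τ ?_⟩
              obtain ⟨O, hO, hτO⟩ := hτs _ subset_rfl (range_nonempty τ)
              exact smallTup_of_forall hfine ⟨O, hO, fun p => hτO (mem_range_self p)⟩
            -- The face of a tuple of length one is empty, so finiteness of its indices is not
            -- available; there the homotopy is zero.
            · rcases Nat.eq_zero_or_pos n with hn | hn
              · rw [hs0 hn]
                exact Submodule.zero_mem _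
              · rw [bd_tup, map_sum]
                refine Submodule.sum_mem _ fun i _ => ?_
                rw [map_smul]
                refine Submodule.smul_mem _ _ (supported_weaken (hs _ (small_face hρ hμ hτ i))
                  fun υ hυ => ⟨fun p => hball ?_, hpull υ ?_⟩)
                · exact nhd_mono (radius_mono hρ (by omega) le_rfl)
                    (nhd_face_subset τ i _ (hυ.1 p))
                -- The face has more indices and a higher level, so its cover after `n` spent stages
                -- refines that of `τ`.
                · have hsub : F ⊆ indices b ρ μ W (range (τ ∘ i.succAbove)) :=
                    indices_antitone (range_comp_subset_range _ _)
                  have hfin : (indices b ρ μ W (range (τ ∘ i.succAbove))).Finite :=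
                    finite_indices hW ⟨_, mem_range_self ⟨0, hn⟩⟩
                  refine smallTup_of_forall (fun O hO => ?_) hυ.2
                  exact exists_cover_superset (Nat.sub_le_sub_right (level_mono hsub hfin) n)
                    (cover_antitone hsub _ hO)
          obtain ⟨w, hw, hws⟩ := (hH (α, n + 1) hα.2).exists_small_filling (R := R)
            (isOpen_of_mem_cover ho)
            (hH.fineCover_isOpenCover ho hc hFf (fun h hh => hh.2) _)
            (isCyc_succ.2 (hc' τ hτ)) hz
          exact ⟨w, supported_weaken hws fun υ hυ => ⟨fun p => hD (hυ.1 p), hυ.2⟩, hw⟩)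
      refine ⟨s', ⟨fun h => (Nat.succ_ne_zero n h).elim, fun τ hτ => (hs' τ hτ).1, fun τ hτ => ?_⟩,
        fun τ hτ => (hs' τ hτ).2⟩
      have := map_eq_of_supported (bd_tup_mem (R := R) (fun i => small_face hρ hμ hτ i))
        (bd R X (n + 1) ∘ₗ s') (S (n + 1) - LinearMap.id - s ∘ₗ bd R X n)
        (fun σ hσ => by
          simp only [LinearMap.comp_apply, LinearMap.sub_apply, LinearMap.id_apply]
          exact (hs' σ hσ).2)
      simp only [LinearMap.comp_apply, LinearMap.sub_apply, LinearMap.id_apply, bd_bd, map_zero,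
        sub_zero] at this
      rw [map_sub, map_sub, hSb _ τ (far_of_small hρ hμ hW1 hτ), this, sub_self])
  refine ⟨T, h0, fun n τ hτ => ?_, hQ⟩
  refine supported_weaken ((hP n).2.1 τ hτ) fun υ hυ => ⟨hυ.1, ?_⟩
  exact smallTup_of_forall (fun O hO => exists_cover_superset (j := 0) (Nat.zero_le _) hO) hυ.2

/-- Tuples in a small neighborhood of a far-out point are small. -/
theorem ContractsSmallBalls.exists_nhds_small {c : X × ℕ → X}
    (hH : ContractsSmallBalls b ρ μ H c) (hρ : Monotone ρ) (hμ : Monotone μ)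
    (ho : ∀ V ∈ 𝒱, IsOpen V) (hc : ⋃₀ 𝒱 = univ) (hW : LocallyFinite W)
    (hWo : ∀ α, IsOpen (W α)) (hWc : ⋃ α, W α = univ)
    (hW1 : ∀ α, W α ⊆ Metric.ball α 1) (k : ℕ) {x : X}
    (hx : smallThreshold ρ μ k + 1 < nndist b x) :
    ∃ O ∈ 𝓝 x, ∀ n ≤ k, ∀ τ : Fin n → X, (∀ i, τ i ∈ O) → τ ∈ small b ρ μ W H 𝒱 n := by
  obtain ⟨O, hO, hOf⟩ := hW x
  have hα : x ∈ ⋃ α, W α := hWc ▸ mem_univ x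
  obtain ⟨α, hα⟩ := mem_iUnion.1 hα
  have hbα : smallThreshold ρ μ k < nndist b α := by
    have h1 : nndist x α ≤ 1 := (Metric.mem_ball.1 (hW1 _ hα)).le
    have h2 := nndist_triangle b α x
    rw [nndist_comm α] at h2
    exact lt_of_add_lt_add_right (hx.trans_le (h2.trans (add_le_add_right h1 _)))
  -- These finitely many indices include those of every nonempty subset of `O`, so one member of the
  -- cover built from them serves all such subsets.
  let F : Set (X × ℕ) :=
    {h | h.1 ∈ {β | (W β ∩ O).Nonempty} ∧ smallThreshold ρ μ h.2 < nndist b h.1}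
  have hF : F.Finite := finite_setOf_smallThreshold_lt hOf
  have hV : x ∈ ⋃₀ cover 𝒱 H (smallBall ρ) F (level F) := by
    rw [hH.fineCover_isOpenCover ho hc hF (fun h hh => hh.2)]
    exact mem_univ x
  obtain ⟨V, hV, hxV⟩ := hV
  refine ⟨O ∩ V ∩ W α, inter_mem (inter_mem hO ((isOpen_of_mem_cover ho V hV).mem_nhds hxV))
    ((hWo α).mem_nhds hα), fun n hn τ hτ => ⟨⟨α, ?_, ?_⟩, ?_⟩⟩
  · rintro _ ⟨i, rfl⟩
    exact (hτ i).2
  · exact (smallThreshold_mono hρ hμ hn).trans_lt hbα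
  · rintro s hs ⟨y, hy⟩
    have hsO : ∀ z ∈ s, z ∈ O ∩ V ∩ W α := fun z hz => by
      obtain ⟨i, rfl⟩ := hs hz
      exact hτ i
    obtain ⟨V', hV', hVV'⟩ := exists_fineCover_superset (s := s) hF
      (fun h hh => ⟨⟨y, hh.1 hy, (hsO y hy).1.1⟩, hh.2⟩) hV
    exact ⟨V', hV', fun z hz => hVV' (hsO z hz).1.2⟩

end Small

/-! ### Controlled chain maps into small chains -/

section SmallChainMap

open Set Filter

variable {R : Type*} [Ring R]

/-- The chain map obtained from `Φ` by adding the boundary of the homotopy `-U`. -/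
def perturb {X : Type*} (Φ : ∀ n, Tup R X n →ₗ[R] Tup R X n)
    (U : ∀ n, Tup R X n →ₗ[R] Tup R X (n + 1)) : ∀ n, Tup R X n →ₗ[R] Tup R X n
  | 0 => Φ 0
  | n + 1 => Φ (n + 1) - bd R X (n + 1) ∘ₗ U (n + 1) - U n ∘ₗ bd R X n

theorem perturb_succ {X : Type*} (Φ : ∀ n, Tup R X n →ₗ[R] Tup R X n)
    (U : ∀ n, Tup R X n →ₗ[R] Tup R X (n + 1)) (n : ℕ) (c : Tup R X (n + 1)) :
    perturb Φ U (n + 1) c =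
      Φ (n + 1) c - bd R X (n + 1) (U (n + 1) c) - U n (bd R X n c) := rfl

/-- Both sides acquire the same term `-∂U∂`; in the lowest degree it vanishes because `U 0 = 0`. -/
theorem bd_perturb {X : Type*} {Φ : ∀ n, Tup R X n →ₗ[R] Tup R X n}
    {U : ∀ n, Tup R X n →ₗ[R] Tup R X (n + 1)} (hU : U 0 = 0) {n : ℕ} {c : Tup R X (n + 1)}
    (h : bd R X n (Φ (n + 1) c) = Φ n (bd R X n c)) :
    bd R X n (perturb Φ U (n + 1) c) = perturb Φ U n (bd R X n c) := by
  rw [perturb_succ, map_sub, map_sub, h, bd_bd, sub_zero]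
  cases n with
  | zero => simp [hU, perturb]
  | succ n => simp [perturb_succ, bd_bd]

variable {X : Type*} [MetricSpace X]

/-- A bound for a numerical function on tuples that is monotone with respect to faces. -/
def faceBound {Y : Type*} (f : ∀ n, (Fin n → Y) → ℕ) : ∀ n, (Fin n → Y) → ℕ
  | 0, τ => f 0 τ
  | n + 1, τ => max (f (n + 1) τ)
      (Finset.univ.sup fun i : Fin (n + 1) => faceBound f n (τ ∘ i.succAbove))

theorem le_faceBound {Y : Type*} (f : ∀ n, (Fin n → Y) → ℕ) {n : ℕ} (τ : Fin n → Y) :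
    f n τ ≤ faceBound f n τ := by
  cases n with
  | zero => exact le_rfl
  | succ n => exact le_max_left _ _

theorem faceBound_face_le {Y : Type*} (f : ∀ n, (Fin n → Y) → ℕ) {n : ℕ} (τ : Fin (n + 1) → Y)
    (i : Fin (n + 1)) : faceBound f n (τ ∘ i.succAbove) ≤ faceBound f (n + 1) τ :=
  (Finset.le_sup (f := fun i : Fin (n + 1) => faceBound f n (τ ∘ i.succAbove))
    (Finset.mem_univ i)).trans (le_max_right _ _)

variable {b : X} {ρ μ : ℝ≥0 → ℝ≥0} {W : X → Set X} {H : X × ℕ → ℝ → X → X} {𝒱 : Set (Set X)}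

/-- There is a chain map on far-out tuples subordinate to the fine covers. -/
theorem ContractsSmallBalls.exists_fine_chain_map {c : X × ℕ → X}
    (hH : ContractsSmallBalls b ρ μ H c) (hX : FarContractible b ρ μ) (hρ : Monotone ρ)
    (hμ : Monotone μ) (ho : ∀ V ∈ 𝒱, IsOpen V) (hc : ⋃₀ 𝒱 = univ) (hW : LocallyFinite W) :
    ∃ S : ∀ n, Tup R X n →ₗ[R] Tup R X n, S 0 = LinearMap.id ∧
      (∀ n, ∀ τ ∈ far b (threshold ρ μ (2 * (n + 1))) (n + 1),
        bd R X n (S (n + 1) (tup R τ)) = S n (bd R X n (tup R τ))) ∧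
      ∀ n, ∀ τ ∈ far b (threshold ρ μ (2 * (n + 1))) (n + 1), S (n + 1) (tup R τ) ∈
        Finsupp.supported R R ({υ | ∀ p, υ p ∈ reach ρ (2 * (n + 1)) τ} ∩
          smallTup (fineCover b ρ μ W H 𝒱 (range τ)) (n + 1)) := by
  obtain ⟨S, hS0, hSr, hSb⟩ := hX.exists_system (R := R) hρ hμ
  obtain ⟨e, he0, her, heb⟩ := hX.exists_system_homotopy hρ hμ hS0 hSr hSb
  have hfine : ∀ s : Set X, s.Nonempty → (∀ V ∈ fineCover b ρ μ W H 𝒱 s, IsOpen V) ∧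
      ⋃₀ fineCover b ρ μ W H 𝒱 s = univ := fun s hs => ⟨isOpen_of_mem_cover ho,
    hH.fineCover_isOpenCover ho hc (finite_indices hW hs) (fun _ hh => hh.2) _⟩
  -- Beyond stage `J`, all chains attached to `τ` are subordinate to the cover attached to its
  -- vertex set.
  have hJ : ∀ n (τ : Fin n → X), ∃ J, τ ∈ far b (threshold ρ μ (2 * n)) n → ∀ j ≥ J,
      e n (tup R τ) j ∈
        Finsupp.supported R R (smallTup (fineCover b ρ μ W H 𝒱 (range τ)) (n + 1)) ∧
      (n ≠ 0 → S n (tup R τ) j ∈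
        Finsupp.supported R R (smallTup (fineCover b ρ μ W H 𝒱 (range τ)) n)) := by
    intro n τ
    by_cases hτ : τ ∈ far b (threshold ρ μ (2 * n)) n
    · cases n with
      | zero =>
        refine ⟨0, fun _ j _ => ⟨?_, fun h => (h rfl).elim⟩⟩
        rw [he0]
        exact Submodule.zero_mem _
      | succ n =>
        obtain ⟨h1, h2⟩ := hfine (range τ) (range_nonempty τ)
        obtain ⟨J, hJ⟩ := eventually_atTop.1 ((ctl_eventually_small (her _ τ hτ) h1 h2).and
          (ctl_eventually_small
            (hSr _ τ (far_threshold_weaken hρ hμ (by omega) hτ)) h1 h2))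
        exact ⟨J, fun _ j hj => ⟨(hJ j hj).1, fun _ => (hJ j hj).2⟩⟩
    · exact ⟨0, fun h => (hτ h).elim⟩
  choose J hJ using hJ
  let m := faceBound J
  let U : ∀ n, Tup R X n →ₗ[R] Tup R X (n + 1) := fun n => Finsupp.linearCombination R fun τ =>
    ∑ j ∈ Finset.range (m n τ), e n (tup R τ) j
  have hU : ∀ n (τ : Fin n → X), U n (tup R τ) = ∑ j ∈ Finset.range (m n τ), e n (tup R τ) j :=
    fun n τ => by simp [U, tup]
  have hU0 : U 0 = 0 := by
    ext τ : 2
    change U 0 (tup R τ) = 0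
    rw [hU, he0]
    simp
  let Φ : ∀ n, Tup R X n →ₗ[R] Tup R X n := fun n => LinearMap.proj 0 ∘ₗ S n
  -- Telescoping replaces stage 0 by stage `m τ`. What remains on a face are the `e j` with `j` at
  -- least the stage chosen for that face, which are already fine for it. This needs `m` to be
  -- monotone under faces.
  have key : ∀ n, ∀ τ ∈ far b (threshold ρ μ (2 * (n + 1))) (n + 1),
      perturb Φ U (n + 1) (tup R τ) = S (n + 1) (tup R τ) (m (n + 1) τ) +
        ∑ i : Fin (n + 1), (-1 : R) ^ (i : ℕ) •
          ∑ j ∈ Finset.Ico (m n (τ ∘ i.succAbove)) (m (n + 1) τ),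
            e n (tup R (τ ∘ i.succAbove)) j := by
    intro n τ hτ
    have h1 : bd R X (n + 1) (U (n + 1) (tup R τ)) = S (n + 1) (tup R τ) 0 -
        S (n + 1) (tup R τ) (m (n + 1) τ) -
        ∑ j ∈ Finset.range (m (n + 1) τ), e n (bd R X n (tup R τ)) j := by
      rw [hU, map_sum, Finset.sum_congr rfl fun j _ => heb n τ hτ j, Finset.sum_sub_distrib,
        Finset.sum_range_sub']
    have h2 : ∑ j ∈ Finset.range (m (n + 1) τ), e n (bd R X n (tup R τ)) j =
        ∑ i : Fin (n + 1), (-1 : R) ^ (i : ℕ) •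
          ∑ j ∈ Finset.range (m (n + 1) τ), e n (tup R (τ ∘ i.succAbove)) j := by
      simp only [Finset.smul_sum]
      rw [Finset.sum_comm]
      refine Finset.sum_congr rfl fun j _ => ?_
      rw [bd_tup, map_sum, Finset.sum_apply]
      exact Finset.sum_congr rfl fun i _ => by rw [map_smul, Pi.smul_apply]
    have h3 : U n (bd R X n (tup R τ)) = ∑ i : Fin (n + 1), (-1 : R) ^ (i : ℕ) •
          ∑ j ∈ Finset.range (m n (τ ∘ i.succAbove)), e n (tup R (τ ∘ i.succAbove)) j := by
      rw [bd_tup, map_sum]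
      exact Finset.sum_congr rfl fun i _ => by rw [map_smul, hU]
    have h4 : ∀ i : Fin (n + 1), ∑ j ∈ Finset.Ico (m n (τ ∘ i.succAbove)) (m (n + 1) τ),
        e n (tup R (τ ∘ i.succAbove)) j =
        ∑ j ∈ Finset.range (m (n + 1) τ), e n (tup R (τ ∘ i.succAbove)) j -
          ∑ j ∈ Finset.range (m n (τ ∘ i.succAbove)), e n (tup R (τ ∘ i.succAbove)) j :=
      fun i => Finset.sum_Ico_eq_sub _ (faceBound_face_le J τ i)
    rw [perturb_succ, h1, h3, h2]
    simp only [h4, smul_sub, Finset.sum_sub_distrib]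
    change S (n + 1) (tup R τ) 0 - _ - _ = _
    abel
  refine ⟨perturb Φ U, ?_, fun n τ hτ => bd_perturb hU0 ?_, fun n τ hτ => ?_⟩
  · change LinearMap.proj 0 ∘ₗ S 0 = _
    rw [hS0]
    rfl
  · exact hSb n τ (far_threshold_weaken hρ hμ (by omega) hτ) 0
  · rw [key n τ hτ]
    have hmem : ∀ {l : ℕ} {c : Tup R X l} {s t : Set (Fin l → X)},
        c ∈ Finsupp.supported R R s → c ∈ Finsupp.supported R R t →
        c ∈ Finsupp.supported R R (s ∩ t) := fun h h' => by
      rw [Finsupp.supported_inter]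
      exact ⟨h, h'⟩
    refine Submodule.add_mem _ (hmem ?_ ?_) (Submodule.sum_mem _ fun i _ =>
      Submodule.smul_mem _ _ (Submodule.sum_mem _ fun j hj => hmem ?_ ?_))
    · exact supported_weaken (ctl_mem_supported
        (hSr _ τ (far_threshold_weaken hρ hμ (by omega) hτ)) _)
        fun υ hυ p => reach_mono hρ (by omega) τ (hυ p)
    · exact (hJ (n + 1) τ hτ _ (le_faceBound J τ)).2 n.succ_ne_zero
    · exact supported_weaken (ctl_mem_supported
        (her _ _ (far_threshold_face hρ hμ (by omega) hτ i)) _) fun υ hυ p =>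
          reach_mono hρ (by omega) τ (reach_face_subset hρ _ τ i (hυ p))
    · rcases Nat.eq_zero_or_pos n with rfl | hn
      · rw [he0]
        exact Submodule.zero_mem _
      · refine supported_weaken (hJ n _ (far_threshold_face hρ hμ (by omega) hτ i) j
          ((le_faceBound J _).trans (Finset.mem_Ico.1 hj).1)).1 fun υ hυ => ?_
        exact smallTup_of_forall (fun O hO => exists_fineCover_superset_of_subset hW
          ⟨_, mem_range_self ⟨0, hn⟩⟩ (range_comp_subset_range _ _) hO) hυ

/-- The threshold function for far-out tuples of length `n`. -/
def farThreshold (ρ μ : ℝ≥0 → ℝ≥0) (n : ℕ) (d : ℝ≥0) : ℝ≥0 := threshold ρ μ (3 * n + 1) (d + 2)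

/-- The control radius for far-out tuples of length `n`. -/
def farRadius (ρ : ℝ≥0 → ℝ≥0) (n : ℕ) (d : ℝ≥0) : ℝ≥0 := radius ρ (3 * n + 1) (d + 2)

theorem farThreshold_mono (hρ : Monotone ρ) (hμ : Monotone μ) {m n : ℕ} {d e : ℝ≥0}
    (hmn : m ≤ n) (hde : d ≤ e) : farThreshold ρ μ m d ≤ farThreshold ρ μ n e :=
  threshold_mono hρ hμ (by omega) (by gcongr)

theorem farRadius_mono (hρ : Monotone ρ) {m n : ℕ} {d e : ℝ≥0}
    (hmn : m ≤ n) (hde : d ≤ e) : farRadius ρ m d ≤ farRadius ρ n e :=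
  radius_mono hρ (by omega) (by gcongr)

theorem far_farThreshold_face (hρ : Monotone ρ) (hμ : Monotone μ) {n : ℕ}
    {τ : Fin (n + 1) → X} (hτ : τ ∈ far b (farThreshold ρ μ (n + 1)) (n + 1)) (i : Fin (n + 1)) :
    τ ∘ i.succAbove ∈ far b (farThreshold ρ μ n) n :=
  far_face (fun _ _ hde => farThreshold_mono hρ hμ n.le_succ hde) hτ i

/-- Far-out tuples map to chains of tuples subordinate to a given open cover, by a chain map that
is homotopic to the identity in a controlled way, constantly so on small tuples. -/
theorem FarContractible.exists_small_chain_map (hX : FarContractible b ρ μ) (hρ : Monotone ρ)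
    (hμ : Monotone μ) (ho : ∀ V ∈ 𝒱, IsOpen V) (hc : ⋃₀ 𝒱 = univ) :
    ∃ (S : ∀ n, Tup R X n →ₗ[R] Tup R X n) (G : ∀ n, Tup R X n →ₗ[R] Tup R X (n + 1)),
      G 0 = 0 ∧
      (∀ n, ∀ τ ∈ far b (farThreshold ρ μ (n + 1)) (n + 1),
        bd R X n (S (n + 1) (tup R τ)) = S n (bd R X n (tup R τ)) ∧
        S (n + 1) (tup R τ) ∈ Finsupp.supported R R (smallTup 𝒱 (n + 1)) ∧
        bd R X (n + 1) (G (n + 1) (tup R τ)) =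
          S (n + 1) (tup R τ) - tup R τ - G n (bd R X n (tup R τ))) ∧
      (∀ n, ∀ τ ∈ far b (farThreshold ρ μ n) n, G n (tup R τ) ∈
        Finsupp.supported R R {υ | ∀ p, υ p ∈ nhd τ (farRadius ρ n (tdiam τ))}) ∧
      ∀ (k : ℕ) (x : X), smallThreshold ρ μ k + 1 < nndist b x →
        ∃ O ∈ 𝓝 x, ∀ n ≤ k, ∀ τ : Fin n → X, (∀ i, τ i ∈ O) → G n (tup R τ) = 0 := by
  classical
  obtain ⟨W, hWo, hWc, hW, hW1⟩ := precise_refinement (fun α : X => Metric.ball α 1)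
    (fun _ => Metric.isOpen_ball)
    (eq_univ_of_forall fun x => mem_iUnion.2 ⟨x, Metric.mem_ball_self one_pos⟩)
  obtain ⟨H, c, hH⟩ := hX.exists_contractsSmallBalls
  obtain ⟨S, hS0, hSb, hSs⟩ := hH.exists_fine_chain_map (R := R) hX hρ hμ ho hc hW
  obtain ⟨T, hT0, hTs, hTb⟩ := hH.exists_small_homotopy hρ hμ ho hc hW hW1 hS0 hSb hSs
  -- Extension by zero loses no control: a tuple that is not small may have small faces, but there
  -- `T` is still subordinate to `𝒱`.
  let T' : ∀ n, Tup R X n →ₗ[R] Tup R X (n + 1) := fun n => Finsupp.linearCombination R fun τ =>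
    if τ ∈ small b ρ μ W H 𝒱 n then T n (tup R τ) else 0
  have hT'1 : ∀ n, ∀ τ ∈ small b ρ μ W H 𝒱 n, T' n (tup R τ) = T n (tup R τ) := fun n τ hτ => by
    simp [T', tup, hτ]
  have hT'2 : ∀ n, ∀ τ ∉ small b ρ μ W H 𝒱 n, T' n (tup R τ) = 0 := fun n τ hτ => by
    simp [T', tup, hτ]
  have hT's : ∀ n (τ : Fin n → X), T' n (tup R τ) ∈ Finsupp.supported R R
      ({υ | ∀ p, υ p ∈ nhd τ (radius ρ (3 * n + 1) 2)} ∩ smallTup 𝒱 (n + 1)) := by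
    intro n τ
    by_cases hτ : τ ∈ small b ρ μ W H 𝒱 n
    · rw [hT'1 n τ hτ]
      exact hTs n τ hτ
    · rw [hT'2 n τ hτ]
      exact Submodule.zero_mem _
  have hT'0 : T' 0 = 0 := by
    ext τ : 2
    change T' 0 (tup R τ) = 0
    by_cases hτ : τ ∈ small b ρ μ W H 𝒱 0
    · rw [hT'1 0 τ hτ, hT0, LinearMap.zero_apply]
    · exact hT'2 0 τ hτ
  have hfar : ∀ {n : ℕ} {τ : Fin n → X}, τ ∈ far b (farThreshold ρ μ n) n →
      τ ∈ far b (threshold ρ μ (2 * n)) n := fun hτ =>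
    far_weaken (fun d => threshold_mono hρ hμ (by omega) le_self_add) hτ
  -- On small tuples the formula for `∂T` cancels everything except the tuple itself.
  have hsmall : ∀ n, ∀ τ ∈ small b ρ μ W H 𝒱 (n + 1),
      perturb S T' (n + 1) (tup R τ) = tup R τ := by
    intro n τ hτ
    have := map_eq_of_supported (bd_tup_mem (R := R) fun i => small_face hρ hμ hτ i)
      (T' n) (T n) (hT'1 n)
    rw [perturb_succ, hT'1 _ τ hτ, hTb n τ hτ, this]
    abel
  have hsupp : ∀ n, ∀ τ ∈ far b (farThreshold ρ μ (n + 1)) (n + 1),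
      perturb S T' (n + 1) (tup R τ) ∈ Finsupp.supported R R
        ({υ | ∀ p, υ p ∈ nhd τ (farRadius ρ (n + 1) (tdiam τ))} ∩ smallTup 𝒱 (n + 1)) := by
    intro n τ hτ
    by_cases hτs : τ ∈ small b ρ μ W H 𝒱 (n + 1)
    · rw [hsmall n τ hτs]
      refine tup_mem_supported ⟨fun p => mem_nhd _ _ _, ?_⟩
      obtain ⟨V, hV, hτV⟩ := hτs.2 _ subset_rfl (range_nonempty τ)
      obtain ⟨V', hV', hVV'⟩ := exists_cover_superset (j := 0) (Nat.zero_le _) hV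
      exact ⟨V', hV', fun p => hVV' (hτV (mem_range_self p))⟩
    -- The argument `tdiam τ + 2` of the control radius dominates both the diameter, needed for `S`,
    -- and 2, needed for `T'`.
    · rw [perturb_succ, hT'2 _ τ hτs, map_zero, sub_zero, bd_tup, map_sum]
      refine Submodule.sub_mem _ (supported_weaken (hSs n τ (hfar hτ)) fun υ hυ =>
          ⟨fun p => ?_, ?_⟩)
        (Submodule.sum_mem _ fun i _ => ?_)
      · exact nhd_mono (radius_mono hρ (by omega) le_self_add) (hυ.1 p)
      · exact smallTup_of_forall (fun O hO => exists_cover_superset (j := 0) (Nat.zero_le _) hO)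
          hυ.2
      · rw [map_smul]
        refine Submodule.smul_mem _ _ (supported_weaken (hT's n _) fun υ hυ =>
          ⟨fun p => ?_, hυ.2⟩)
        exact nhd_mono (radius_mono hρ (by omega) le_add_self) (nhd_face_subset τ i _ (hυ.1 p))
  have hchain : ∀ n, ∀ τ ∈ far b (farThreshold ρ μ (n + 1)) (n + 1),
      bd R X n (perturb S T' (n + 1) (tup R τ)) = perturb S T' n (bd R X n (tup R τ)) :=
    fun n τ hτ => bd_perturb hT'0 (hSb n τ (hfar hτ))
  let Φ : ∀ n, Tup R X n →ₗ[R] Tup R X n := fun n => perturb S T' n - LinearMap.id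
  have hface : ∀ n, ∀ τ ∈ far b (farThreshold ρ μ (n + 1)) (n + 1), ∀ i : Fin (n + 1),
      τ ∘ i.succAbove ∈ far b (farThreshold ρ μ n) n :=
    fun n τ hτ i => far_farThreshold_face hρ hμ hτ i
  -- Coning from the first vertex preserves control, and gives zero wherever `Φ` vanishes on a tuple
  -- and all its faces.
  refine ⟨perturb S T', htpy Φ id, rfl, fun n τ hτ => ⟨hchain n τ hτ, ?_, ?_⟩, ?_, ?_⟩
  · exact supported_weaken (hsupp n τ hτ) fun υ hυ => hυ.2
  · refine bd_htpy (Φ := Φ) id (A := fun n => far b (farThreshold ρ μ n) n) hface ?_ ?_ n τ hτ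
    · exact sub_eq_zero.2 hS0
    · intro n τ hτ
      simp only [Φ, LinearMap.sub_apply, LinearMap.id_apply, map_sub, hchain n τ hτ]
  · refine htpy_mem (Φ := Φ) hface (N := fun n τ => nhd τ (farRadius ρ n (tdiam τ))) ?_ ?_ ?_
    · exact fun n τ _ i => (nhd_face_subset τ i _).trans
        (nhd_mono (farRadius_mono hρ n.le_succ (tdiam_face_le τ i)))
    · exact fun n τ _ => mem_nhd _ _ _
    · intro n τ hτ
      exact Submodule.sub_mem _ (supported_weaken (hsupp n τ hτ) fun υ hυ => hυ.1)
        (tup_mem_supported fun p => mem_nhd _ _ _)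
  · intro k x hx
    obtain ⟨O, hO, h⟩ := hH.exists_nhds_small hρ hμ ho hc hW hWo hWc hW1 k hx
    refine ⟨O, hO, fun n hn τ hτ => htpy_eq_zero (Φ := Φ) (A := small b ρ μ W H 𝒱)
      (fun n τ hτ i => small_face hρ hμ hτ i) (fun n τ hτ => ?_) n τ (h n hn τ hτ)⟩
    simp only [Φ, LinearMap.sub_apply, LinearMap.id_apply, hsmall n τ hτ, sub_self]

end SmallChainMap

/-! ### Affine realization of tuples -/

section Realization

open Set

variable {R : Type*} [Ring R] {E : Type*} [NormedAddCommGroup E] [NormedSpace ℝ E]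
  {X N : Set E} {n : ℕ}

/-- The affine simplex spanned by a tuple lies in `N`. -/
def SpansIn (N : Set E) (υ : Fin n → X) : Prop :=
  ∀ p : stdSimplex ℝ (Fin n), ∑ i, p i • (υ i : E) ∈ N

theorem continuous_sum_smul {ι : Type*} [Fintype ι] (v : ι → E) :
    Continuous fun p : stdSimplex ℝ ι => ∑ i, p i • v i := by
  refine continuous_finsetSum _ fun i _ => Continuous.smul ?_ continuous_const
  exact (continuous_apply i).comp continuous_subtype_val

/-- The affine singular simplex spanned by a tuple. -/
def affineSimplex (υ : Fin (n + 1) → X) (h : SpansIn N υ) : SingularSimplex N n :=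
  ⟨fun p => ⟨∑ i, p i • (υ i : E), h p⟩,
    (continuous_sum_smul fun i => (υ i : E)).subtype_mk _⟩

/-- Both sides extend linearly in `p`, so unit vectors suffice. -/
theorem sum_map_smul {ι κ : Type*} [Fintype ι] [Fintype κ] (f : ι → κ) (p : stdSimplex ℝ ι)
    (v : κ → E) : ∑ j, stdSimplex.map f p j • v j = ∑ i, p i • v (f i) := by
  classical
  have h : (∑ j, (LinearMap.toSpanSingleton ℝ E (v j)) ∘ₗ LinearMap.proj j) ∘ₗ
      FunOnFinite.linearMap ℝ ℝ f =
      ∑ i, (LinearMap.toSpanSingleton ℝ E (v (f i))) ∘ₗ LinearMap.proj i := by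
    refine LinearMap.pi_ext' fun i => LinearMap.ext_ring ?_
    simp only [LinearMap.comp_apply, LinearMap.coe_single, FunOnFinite.linearMap_piSingle,
      LinearMap.sum_apply, LinearMap.proj_apply, LinearMap.toSpanSingleton_apply]
    simp [Pi.single_apply, ite_smul]
  have := LinearMap.congr_fun h p
  simpa [LinearMap.sum_apply] using this

theorem SpansIn.face {υ : Fin (n + 1) → X} (h : SpansIn N υ) (i : Fin (n + 1)) :
    SpansIn N (υ ∘ i.succAbove) := fun p => by
  have := h (stdSimplex.map i.succAbove p)
  rwa [sum_map_smul i.succAbove p fun j => (υ j : E)] at this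

theorem singularFace_affineSimplex (υ : Fin (n + 2) → X) (h : SpansIn N υ) (i : Fin (n + 2)) :
    singularFace (affineSimplex υ h) i = affineSimplex (υ ∘ i.succAbove) (h.face i) := by
  ext p
  exact sum_map_smul i.succAbove p fun j => (υ j : E)

open Classical in
/-- The affine realization of chains of tuples. -/
def realize (R : Type*) [Ring R] (X N : Set E) (n : ℕ) :
    Tup R X (n + 1) →ₗ[R] SingularChain R N n :=
  Finsupp.linearCombination R fun υ =>
    if h : SpansIn N υ then Finsupp.single (affineSimplex υ h) 1 else 0

theorem realize_tup (υ : Fin (n + 1) → X) (h : SpansIn N υ) :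
    realize R X N n (tup R υ) = Finsupp.single (affineSimplex υ h) 1 := by
  simp [realize, tup, h]

theorem singularBoundary_realize {c : Tup R X (n + 2)}
    (hc : c ∈ Finsupp.supported R R {υ | SpansIn N υ}) :
    singularBoundary R N n (realize R X N (n + 1) c) =
      realize R X N n (bd R X (n + 1) c) := by
  refine map_eq_of_supported hc (singularBoundary R N n ∘ₗ realize R X N (n + 1))
    (realize R X N n ∘ₗ bd R X (n + 1)) fun υ hυ => ?_
  change singularBoundary R N n (realize R X N (n + 1) (tup R υ)) =
    realize R X N n (bd R X (n + 1) (tup R υ))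
  rw [realize_tup υ hυ, bd_tup, map_sum, singularBoundary, Finsupp.linearCombination_single,
    one_smul]
  refine Finset.sum_congr rfl fun i _ => ?_
  rw [map_smul, realize_tup _ (SpansIn.face hυ i), singularFace_affineSimplex, Finsupp.smul_single,
    smul_eq_mul, mul_one]

theorem vertexMap_realize (hXN : X ⊆ N) {c : Tup R X (n + 1)}
    (hc : c ∈ Finsupp.supported R R {υ | SpansIn N υ}) :
    vertexMap R N n (realize R X N n c) = tupleInclusion R hXN n c := by
  refine map_eq_of_supported hc (vertexMap R N n ∘ₗ realize R X N n)
    (tupleInclusion R hXN n) fun υ hυ => ?_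
  change vertexMap R N n (realize R X N n (tup R υ)) = tupleInclusion R hXN n (tup R υ)
  rw [realize_tup υ hυ, vertexMap, tupleInclusion, Finsupp.lmapDomain_apply,
    Finsupp.mapDomain_single, Finsupp.lmapDomain_apply, Finsupp.mapDomain_single]
  congr 1
  funext i
  refine Subtype.ext ?_
  change ∑ j, (stdSimplex.vertex i : stdSimplex ℝ (Fin (n + 1))) j • (υ j : E) = υ i
  rw [stdSimplex.vertex_coe]
  simp [Pi.single_apply, ite_smul]

theorem realize_mem_smallChains {𝒰 : Set (Set E)} {c : Tup R X (n + 1)}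
    (hc : c ∈ Finsupp.supported R R
      {υ : Fin (n + 1) → X | ∃ U ∈ 𝒰, SpansIn N υ ∧ SpansIn U υ}) :
    realize R X N n c ∈ smallChains R N 𝒰 n := by
  refine map_mem_of_supported hc _ _ fun υ hυ => ?_
  obtain ⟨U, hU, h, hU'⟩ := hυ
  change realize R X N n (tup R υ) ∈ _
  rw [realize_tup υ h]
  exact Finsupp.single_mem_supported R 1 ⟨U, hU, hU'⟩

/-- The open subsets of `X` that lie in a convex set inside both `N` and a member of `𝒰`. -/
def convexlySmall (X N : Set E) (𝒰 : Set (Set E)) : Set (Set X) :=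
  {O | IsOpen O ∧ ∃ C : Set E, Convex ℝ C ∧ C ⊆ N ∧ (∃ U ∈ 𝒰, C ⊆ U) ∧ ∀ x ∈ O, (x : E) ∈ C}

theorem sUnion_convexlySmall (hN : IsOpen N) (hXN : X ⊆ N) {𝒰 : Set (Set E)}
    (h𝒰 : ∀ U ∈ 𝒰, IsOpen U) (hN𝒰 : N ⊆ ⋃₀ 𝒰) : ⋃₀ convexlySmall X N 𝒰 = univ := by
  refine eq_univ_of_forall fun x => ?_
  obtain ⟨U, hU, hxU⟩ := hN𝒰 (hXN x.2)
  obtain ⟨r, hr, hb⟩ := Metric.isOpen_iff.1 (hN.inter (h𝒰 U hU)) x ⟨hXN x.2, hxU⟩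
  exact ⟨Subtype.val ⁻¹' Metric.ball (x : E) r, ⟨Metric.isOpen_ball.preimage
    continuous_subtype_val, Metric.ball x r, convex_ball _ _, fun y hy => (hb hy).1,
    ⟨U, hU, fun y hy => (hb hy).2⟩, fun _ hy => hy⟩, Metric.mem_ball_self hr⟩

theorem spansIn_of_mem_smallTup {𝒰 : Set (Set E)} {υ : Fin n → X}
    (hυ : υ ∈ smallTup (convexlySmall X N 𝒰) n) :
    ∃ U ∈ 𝒰, SpansIn N υ ∧ SpansIn U υ := by
  obtain ⟨O, ⟨-, C, hC, hCN, ⟨U, hU, hCU⟩, hOC⟩, hυO⟩ := hυ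
  have h : SpansIn C υ := fun p => hC.sum_mem (fun i _ => stdSimplex.zero_le p i)
    (stdSimplex.sum_eq_one p) fun i _ => hOC _ (hυO i)
  exact ⟨U, hU, fun p => hCN (h p), fun p => hCU (h p)⟩

end Realization

end CoarseFilling

end

/-! ### Proof of the proposition -/

open CoarseFilling

theorem mainTheorem10 (R : Type*) [Ring R] (I : Type*)
    (X N : Set (CoarseFilling.EllInf I))
    (hX : CoarseFilling.UniformlyContractibleAtInfinity X)
    (b : X) (hN : IsOpen N) (hXN : X ⊆ N)
    (𝒰 : Set (Set (CoarseFilling.EllInf I)))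
    (h𝒰 : ∀ U ∈ 𝒰, IsOpen U) (hN𝒰 : N ⊆ ⋃₀ 𝒰) :
    ∃ ρ μ : ℕ → ℝ≥0 → ℝ≥0,
      (∀ n, Monotone (ρ n)) ∧ Monotone ρ ∧ (∀ n, Monotone (μ n)) ∧ Monotone μ ∧
      -- the far-out simplices span a subcomplex
      ∃ hF : ∀ (n : ℕ) (c : CoarseFilling.farChains R b μ (n + 1)),
          CoarseFilling.tupleBoundary R X n c ∈ CoarseFilling.farChains R b μ n,
      ∃ (S : ∀ n, CoarseFilling.farChains R b μ n →ₗ[R] CoarseFilling.smallChains R N 𝒰 n)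
        (G : ∀ n, CoarseFilling.farChains R b μ n →ₗ[R] CoarseFilling.TupleChain R N (n + 1)),
        -- `S` is a chain map
        (∀ (n : ℕ) (c : CoarseFilling.farChains R b μ (n + 1)),
          CoarseFilling.singularBoundary R N n (S (n + 1) c) =
            S n ⟨CoarseFilling.tupleBoundary R X n c, hF n c⟩) ∧
        -- `G` is a chain homotopy between `V S` and the inclusion
        (∀ c : CoarseFilling.farChains R b μ 0,
          CoarseFilling.tupleBoundary R N 0 (G 0 c) =
            CoarseFilling.vertexMap R N 0 (S 0 c) - CoarseFilling.tupleInclusion R hXN 0 c) ∧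
        (∀ (n : ℕ) (c : CoarseFilling.farChains R b μ (n + 1)),
          CoarseFilling.tupleBoundary R N (n + 1) (G (n + 1) c) =
            CoarseFilling.vertexMap R N (n + 1) (S (n + 1) c) -
              CoarseFilling.tupleInclusion R hXN (n + 1) c -
              G n ⟨CoarseFilling.tupleBoundary R X n c, hF n c⟩) ∧
        -- the support of `G` is controlled
        (∀ (n : ℕ) (σ : Fin (n + 1) → X) (hσ : CoarseFilling.IsFar b (μ n) σ),
          ∀ τ ∈ (G n (CoarseFilling.farSimplex R σ hσ)).support, ∀ j,
            (τ j : CoarseFilling.EllInf I) ∈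
              Metric.thickening (ρ n (CoarseFilling.nndiam (Set.range σ)))
                (Set.range fun i => (σ i : CoarseFilling.EllInf I))) ∧
        -- small simplices far out are sent into small sets
        (∀ k : ℕ, ∃ B : Set X, Bornology.IsBounded B ∧ ∀ x : X, x ∉ B →
          ∀ U ∈ 𝓝 (x : CoarseFilling.EllInf I), ∃ W ∈ 𝓝 x, ∀ n ≤ k,
            ∀ σ : Fin (n + 1) → X, (∀ i, σ i ∈ W) →
              ∃ hσ : CoarseFilling.IsFar b (μ n) σ,
                ∀ τ ∈ (G n (CoarseFilling.farSimplex R σ hσ)).support, ∀ j,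
                  (τ j : CoarseFilling.EllInf I) ∈ U) := by

  obtain ⟨ρ, μ, hρ, hμ, hfc⟩ := hX.farContractible b
  obtain ⟨S, G, hG0, hSG, hGs, hsmall⟩ := hfc.exists_small_chain_map (R := R)
    (𝒱 := convexlySmall X N 𝒰) hρ hμ (fun O hO => hO.1) (sUnion_convexlySmall hN hXN h𝒰 hN𝒰)
  -- An `n`-simplex is a tuple of length `n + 1`.
  let m : ℕ → ℝ≥0 → ℝ≥0 := fun n => farThreshold ρ μ (n + 1)
  have hfar : ∀ {n : ℕ} {c : TupleChain R X n}, c ∈ farChains R b m n →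
      c ∈ Finsupp.supported R R (far b (farThreshold ρ μ (n + 1)) (n + 1)) := fun hc =>
    supported_weaken hc fun τ hτ => isFar_iff.1 hτ
  have hspan : ∀ {n : ℕ} {c : TupleChain R X n}, c ∈ farChains R b m n →
      S (n + 1) c ∈ Finsupp.supported R R
        {υ : Fin (n + 1) → X | ∃ U ∈ 𝒰, SpansIn N υ ∧ SpansIn U υ} := fun {n c} hc =>
    map_mem_of_supported (hfar hc) (S (n + 1)) _ fun τ hτ =>
      supported_weaken (hSG n τ hτ).2.1 fun υ hυ => spansIn_of_mem_smallTup hυ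
  have hspan' : ∀ {n : ℕ} {c : TupleChain R X n}, c ∈ farChains R b m n →
      S (n + 1) c ∈ Finsupp.supported R R {υ : Fin (n + 1) → X | SpansIn N υ} := fun hc =>
    supported_weaken (hspan hc) fun υ ⟨_, _, h, _⟩ => h
  have hGb : ∀ {n : ℕ} {c : TupleChain R X n}, c ∈ farChains R b m n →
      bd R X (n + 1) (G (n + 1) c) = S (n + 1) c - c - G n (bd R X n c) := fun {n c} hc =>
    map_eq_of_supported (hfar hc) (bd R X (n + 1) ∘ₗ G (n + 1))
      (S (n + 1) - LinearMap.id - G n ∘ₗ bd R X n) fun τ hτ => (hSG n τ hτ).2.2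
  -- The added 1 turns a closed distance bound into an open neighborhood.
  refine ⟨fun n d => farRadius ρ (n + 1) d + 1, m, fun n d e h =>
      add_le_add_left (farRadius_mono hρ le_rfl h) 1, fun n k h d =>
      add_le_add_left (farRadius_mono hρ (by omega) le_rfl) 1,
    fun n d e h => farThreshold_mono hρ hμ le_rfl h,
    fun n k h d => farThreshold_mono hρ hμ (by omega) le_rfl, fun n c => ?_,
    fun n => (realize R X N n ∘ₗ S (n + 1) ∘ₗ (farChains R b m n).subtype).codRestrict _
      fun c => realize_mem_smallChains (hspan c.2),
    fun n => mapTup R (Set.inclusion hXN) (n + 2) ∘ₗ G (n + 1) ∘ₗ (farChains R b m n).subtype,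
    ?_, ?_, ?_, ?_, ?_⟩
  · refine map_mem_of_supported (hfar c.2) (bd R X (n + 1)) _ fun τ hτ => ?_
    exact bd_tup_mem fun i => isFar_iff.2 (far_farThreshold_face hρ hμ hτ i)
  · intro n c
    have h := map_eq_of_supported (hfar c.2) (bd R X (n + 1) ∘ₗ S (n + 2))
      (S (n + 1) ∘ₗ bd R X (n + 1)) fun τ hτ => (hSG (n + 1) τ hτ).1
    exact (singularBoundary_realize (hspan' c.2)).trans (congrArg (realize R X N n) h)
  · intro c
    have h := congrArg (mapTup R (Set.inclusion hXN) 1) (hGb c.2)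
    -- The augmentation term disappears because `G` is zero in length 0.
    rw [hG0, LinearMap.zero_apply, sub_zero, map_sub, ← bd_mapTup] at h
    exact h.trans (congrArg (· - _) (vertexMap_realize hXN (hspan' c.2)).symm)
  · intro n c
    have h := congrArg (mapTup R (Set.inclusion hXN) (n + 2)) (hGb c.2)
    rw [map_sub, map_sub, ← bd_mapTup] at h
    exact h.trans (congrArg (· - _ - _) (vertexMap_realize hXN (hspan' c.2)).symm)
  · intro n σ hσ τ hτ j
    have hmem : mapTup R (Set.inclusion hXN) (n + 2) (G (n + 1) (tup R σ)) ∈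
        Finsupp.supported R R {τ : Fin (n + 2) → N | ∀ p, (τ p : EllInf I) ∈
          Metric.thickening (farRadius ρ (n + 1) (tdiam σ) + 1 : ℝ≥0)
            (Set.range fun i => (σ i : EllInf I))} := by
      refine map_mem_of_supported (hGs (n + 1) σ (isFar_iff.1 hσ)) _ _ fun υ hυ => ?_
      change mapTup R (Set.inclusion hXN) (n + 2) (tup R υ) ∈ _
      rw [mapTup_tup]
      refine tup_mem_supported fun p => ?_
      obtain ⟨i, hi⟩ := hυ p
      refine Metric.mem_thickening_iff.2 ⟨_, Set.mem_range_self i, ?_⟩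
      have h1 : dist (υ p) (σ i) ≤ farRadius ρ (n + 1) (tdiam σ) := hi
      refine lt_of_le_of_lt h1 ?_
      push_cast
      exact lt_add_one _
    exact (Finsupp.mem_supported R _).1 hmem hτ j
  · intro k
    -- The first bound makes `G` vanish on tuples near `x`. The second makes tuples in the unit ball
    -- around `x` far: their diameter is at most 2, and they are closer to `b` than `x` by at most
    -- 1.
    refine ⟨Metric.closedBall b (max (smallThreshold ρ μ (k + 1) + 1)
      (farThreshold ρ μ (k + 1) 2 + 1) : ℝ≥0), Metric.isBounded_closedBall, fun x hx U hU => ?_⟩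
    have hx' : max (smallThreshold ρ μ (k + 1) + 1) (farThreshold ρ μ (k + 1) 2 + 1) <
        nndist b x := by
      rw [nndist_comm]
      exact not_le.1 hx
    obtain ⟨O, hO, h⟩ := hsmall (k + 1) x ((le_max_left _ _).trans_lt hx')
    refine ⟨O ∩ Metric.ball x 1, Filter.inter_mem hO (Metric.ball_mem_nhds x one_pos),
      fun n hn σ hσ => ?_⟩
    have hσ1 : ∀ i, nndist (σ i) x ≤ 1 := fun i => (Metric.mem_ball.1 (hσ i).2).le
    have hd : tdiam σ ≤ 2 := by
      refine tdiam_le fun i j => (nndist_triangle_right _ _ x).trans ?_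
      exact (add_le_add (hσ1 i) (hσ1 j)).trans (by norm_num)
    refine ⟨isFar_iff.2 fun i => ?_, fun τ hτ => ?_⟩
    · have h1 := (le_max_right _ _).trans_lt hx'
      have h2 := (nndist_triangle b (σ i) x).trans (add_le_add_right (hσ1 i) _)
      exact (farThreshold_mono hρ hμ (by omega) hd).trans_lt
        (lt_of_add_lt_add_right (h1.trans_le h2))
    · have h0 : mapTup R (Set.inclusion hXN) (n + 2) (G (n + 1) (tup R σ)) = 0 := by
        rw [h (n + 1) (by omega) σ fun i => (hσ i).1, map_zero]
      have hτ' : τ ∈ (mapTup R (Set.inclusion hXN) (n + 2) (G (n + 1) (tup R σ))).support := hτ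
      rw [h0] at hτ'
      simp at hτ'
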